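/- Let $n>1$. Then there is a closed discrete subset $D\subset\mathbb{C}^n$ such that the blowup $\operatorname{Bl}_D\mathbb{C}^n$ of $\mathbb{C}^n$ along $D$, which is a connected, Hausdorff, second countable complex manifold of dimension $n$, has the following properties. 1. $\operatorname{Bl}_D\mathbb{C}^n$ is Brody volume hyperbolic: there is no holomorphic map $\mathbb{C}^n\to\operatorname{Bl}_D\mathbb{C}^n$ which is locally biholomorphic at some point. 2. $\operatorname{Bl}_D\mathbb{C}^n$ is not an Oka manifold. 3. $\mathbb{C}^n$ is an Oka manifold, and $\mathbb{C}^n$ and $\operatorname{Bl}_D\mathbb{C}^n$ are bimeromorphic. In particular, the Oka property is not a bimeromorphic invariant. Here a complex manifold $Y$ is an Oka manifold if for every $N$ and every compact convex set $K\subset\mathbb{C}^N$, any holomorphic map from an open neighborhood of $K$ to $Y$ can be uniformly approximated on $K$ by holomorphic maps $\mathbb{C}^N\to Y$. Complex manifolds $X$ and $Y$ are bimeromorphic if there is a closed analytic subset $\Gamma\subset X\times Y$ whose projections to $X$ and to $Y$ are both proper modifications (proper surjective maps which are biholomorphic over the complement of a nowhere dense closed analytic subset with nowhere dense preimage in $\Gamma$).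 -/

import Mathlib

open Set Topology
open scoped Manifold ContDiff LinearAlgebra.Projectivization

/-- Complex `n`-space. -/
abbrev Cn (n : ℕ) : Type := EuclideanSpace ℂ (Fin n)

/-! ### Complex manifolds, the Oka property, Brody volume hyperbolicity, bimeromorphic equivalence

Holomorphic maps are the complex-analytic ones, `ContMDiff _ _ ω` over `ℂ`. -/

/-- `Y` is an `n`-dimensional complex manifold: holomorphically compatible charts, Hausdorff,
second countable and connected. -/
structure IsComplexManifold (n : ℕ) (Y : Type*) [TopologicalSpace Y] [ChartedSpace (Cn n) Y] :
    Prop where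
  isManifold : IsManifold 𝓘(ℂ, Cn n) ω Y
  t2 : T2Space Y
  secondCountable : SecondCountableTopology Y
  connected : ConnectedSpace Y

/-- The Oka property: every holomorphic map from an open neighbourhood of a compact convex set
`K ⊆ ℂᴺ` to `Y` is, on `K`, a uniform limit of holomorphic maps `ℂᴺ → Y`.
The topology of `C(K, Y)` is the compact-open topology, that is, since `K` is compact, the topology
of uniform convergence for any metric inducing the topology of `Y`. -/
def IsOka (n : ℕ) (Y : Type*) [TopologicalSpace Y] [ChartedSpace (Cn n) Y] : Prop :=
  ∀ (N : ℕ) (K U : Set (Cn N)), IsCompact K → Convex ℝ K → IsOpen U → K ⊆ U →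
    ∀ f : Cn N → Y, ContMDiffOn 𝓘(ℂ, Cn N) 𝓘(ℂ, Cn n) ω f U →
    ∀ φ : C(K, Y), (∀ x : K, φ x = f x) →
      φ ∈ closure {ψ : C(K, Y) | ∃ g : Cn N → Y,
        ContMDiff 𝓘(ℂ, Cn N) 𝓘(ℂ, Cn n) ω g ∧ ∀ x : K, ψ x = g x}

/-- An `n`-dimensional complex manifold is Brody volume hyperbolic if no holomorphic map from `ℂⁿ`
to it is locally biholomorphic at some point. -/
def IsBrodyVolumeHyperbolic (n : ℕ) (Y : Type*) [TopologicalSpace Y] [ChartedSpace (Cn n) Y] :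
    Prop :=
  ¬ ∃ f : Cn n → Y, ContMDiff 𝓘(ℂ, Cn n) 𝓘(ℂ, Cn n) ω f ∧
    ∃ z : Cn n, IsLocalDiffeomorphAt 𝓘(ℂ, Cn n) 𝓘(ℂ, Cn n) ω f z

/-- A closed analytic subset: near every point of `M` it is the common zero set of finitely many
holomorphic functions. -/
def IsAnalyticSubset {E H M : Type*} [NormedAddCommGroup E] [NormedSpace ℂ E] [TopologicalSpace H]
    (I : ModelWithCorners ℂ E H) [TopologicalSpace M] [ChartedSpace H M] (A : Set M) : Prop :=
  ∀ x : M, ∃ U : Set M, IsOpen U ∧ x ∈ U ∧ ∃ (k : ℕ) (f : Fin k → M → ℂ),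
    (∀ j, ContMDiffOn I 𝓘(ℂ, ℂ) ω (f j) U) ∧ A ∩ U = {y ∈ U | ∀ j, f j y = 0}

/-- `Γ ⊆ X × Y` is the graph of a meromorphic map from `X` to `Y`: it is analytic, and its
projection to `X` is a proper modification, i.e. it is proper and surjective, and away from a
nowhere dense analytic set `A ⊆ X`, whose preimage in `Γ` is nowhere dense, it is biholomorphic,
so that `Γ` is there the graph of a holomorphic map. -/
def IsMeromorphicGraph (n m : ℕ) (X Y : Type*) [TopologicalSpace X] [ChartedSpace (Cn n) X]
    [TopologicalSpace Y] [ChartedSpace (Cn m) Y] (Γ : Set (X × Y)) : Prop :=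
  IsAnalyticSubset (𝓘(ℂ, Cn n).prod 𝓘(ℂ, Cn m)) Γ ∧
  IsProperMap (fun p : Γ => p.1.1) ∧ Function.Surjective (fun p : Γ => p.1.1) ∧
  ∃ A : Set X, IsAnalyticSubset 𝓘(ℂ, Cn n) A ∧ IsNowhereDense A ∧
    Γ ⊆ closure {p ∈ Γ | p.1 ∉ A} ∧
    ∃ f : X → Y, ContMDiffOn 𝓘(ℂ, Cn n) 𝓘(ℂ, Cn m) ω f Aᶜ ∧
      ∀ x ∉ A, ∀ y, (x, y) ∈ Γ ↔ y = f x

/-- `X` and `Y` are bimeromorphic: some meromorphic map from `X` to `Y` has a meromorphic inverse. -/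
def IsBimeromorphic (n m : ℕ) (X Y : Type*) [TopologicalSpace X] [ChartedSpace (Cn n) X]
    [TopologicalSpace Y] [ChartedSpace (Cn m) Y] : Prop :=
  ∃ Γ : Set (X × Y), IsMeromorphicGraph n m X Y Γ ∧
    IsMeromorphicGraph m n Y X (Prod.swap ⁻¹' Γ)

/-! ### Projective space -/

noncomputable section

/-- Projective space carries the quotient topology of `ℂⁿ \ {0}`. -/
instance instTopologicalSpaceProj (n : ℕ) : TopologicalSpace (ℙ ℂ (Cn n)) :=
  inferInstanceAs (TopologicalSpace (Quotient (projectivizationSetoid ℂ (Cn n))))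

namespace Proj

variable {n : ℕ}

theorem continuous_mk' : Continuous (Projectivization.mk' ℂ : {v : Cn n // v ≠ 0} → ℙ ℂ (Cn n)) :=
  continuous_quotient_mk'

theorem isOpenQuotientMap_mk' :
    IsOpenQuotientMap (Projectivization.mk' ℂ : {v : Cn n // v ≠ 0} → ℙ ℂ (Cn n)) := by
  refine ⟨fun x => ⟨⟨x.rep, x.rep_nonzero⟩, x.mk_rep⟩, continuous_mk', fun U hU => ?_⟩
  change IsOpen ((Projectivization.mk' ℂ : {v : Cn n // v ≠ 0} → ℙ ℂ (Cn n)) ⁻¹'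
    (Projectivization.mk' ℂ '' U))
  have : (Projectivization.mk' ℂ : {v : Cn n // v ≠ 0} → ℙ ℂ (Cn n)) ⁻¹'
      (Projectivization.mk' ℂ '' U) = ⋃ a : ℂˣ,
        (fun v : {v : Cn n // v ≠ 0} =>
          (⟨a • v.1, by simpa [Units.smul_def] using v.2⟩ : {v : Cn n // v ≠ 0})) ⁻¹' U := by
    ext v
    simp only [mem_preimage, mem_image, mem_iUnion, Projectivization.mk'_eq_mk]
    constructor
    · rintro ⟨u, hu, h⟩
      obtain ⟨a, ha⟩ := (Projectivization.mk_eq_mk_iff ℂ _ _ _ _).1 h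
      refine ⟨a, ?_⟩
      convert hu
    · rintro ⟨a, ha⟩
      exact ⟨_, ha, (Projectivization.mk_eq_mk_iff ℂ _ _ _ _).2 ⟨a, rfl⟩⟩
  rw [this]
  refine isOpen_iUnion fun a => hU.preimage ?_
  refine Continuous.subtype_mk ?_ _
  simp only [Units.smul_def]
  fun_prop

theorem continuousOn_mk {X : Type*} [TopologicalSpace X] {s : Set X} {f : X → Cn n}
    (hf : ContinuousOn f s) (h0 : ∀ x ∈ s, f x ≠ 0) {g : X → ℙ ℂ (Cn n)}
    (hg : ∀ x (hx : x ∈ s), g x = Projectivization.mk ℂ (f x) (h0 x hx)) : ContinuousOn g s := by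
  rw [continuousOn_iff_continuous_domRestrict] at hf ⊢
  have : s.domRestrict g = Projectivization.mk' ℂ ∘
      (fun x : s => (⟨s.domRestrict f x, h0 x x.2⟩ : {v : Cn n // v ≠ 0})) := by
    ext x
    exact hg x x.2
  rw [this]
  exact continuous_mk'.comp (hf.subtype_mk _)

theorem rep_mk_ne {v : Cn n} (hv : v ≠ 0) (i : Fin n) :
    (Projectivization.mk ℂ v hv).rep i ≠ 0 ↔ v i ≠ 0 := by
  obtain ⟨a, ha⟩ := Projectivization.exists_smul_eq_mk_rep ℂ v hv
  rw [← ha]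
  simp [Units.smul_def]

theorem rep_mk_div {v : Cn n} (hv : v ≠ 0) (i j : Fin n) :
    (Projectivization.mk ℂ v hv).rep j / (Projectivization.mk ℂ v hv).rep i = v j / v i := by
  obtain ⟨a, ha⟩ := Projectivization.exists_smul_eq_mk_rep ℂ v hv
  rw [← ha]
  simp only [Units.smul_def, PiLp.smul_apply, smul_eq_mul]
  exact mul_div_mul_left _ _ a.ne_zero

theorem isOpen_rep_ne (i : Fin n) : IsOpen {x : ℙ ℂ (Cn n) | x.rep i ≠ 0} := by
  rw [← isOpenQuotientMap_mk'.isQuotientMap.isOpen_preimage]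
  have : (Projectivization.mk' ℂ : {v : Cn n // v ≠ 0} → ℙ ℂ (Cn n)) ⁻¹' {x | x.rep i ≠ 0} =
      {v | v.1 i ≠ 0} := by
    ext v
    exact rep_mk_ne v.2 i
  rw [this]
  exact isOpen_ne_fun (by fun_prop) continuous_const

theorem continuousOn_rep_div (i j : Fin n) :
    ContinuousOn (fun x : ℙ ℂ (Cn n) => x.rep j / x.rep i) {x | x.rep i ≠ 0} := by
  intro x hx
  refine ContinuousAt.continuousWithinAt ?_
  induction x with
  | h v hv =>
    have hvi : v i ≠ 0 := (rep_mk_ne hv i).1 hx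
    have := (isOpenQuotientMap_mk' (n := n)).continuousAt_comp_iff
      (g := fun x : ℙ ℂ (Cn n) => x.rep j / x.rep i) (x := ⟨v, hv⟩)
    refine this.1 ?_
    have h2 : (fun x : ℙ ℂ (Cn n) => x.rep j / x.rep i) ∘ Projectivization.mk' ℂ =
        fun v : {v : Cn n // v ≠ 0} => v.1 j / v.1 i := by
      ext v
      exact rep_mk_div v.2 i j
    rw [h2]
    exact ContinuousAt.div (by fun_prop) (by fun_prop) hvi

theorem mk_eq_of_mem {v : Cn n} (hv : v ≠ 0) {x : ℙ ℂ (Cn n)} (h : v ∈ x.submodule) :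
    x = Projectivization.mk ℂ v hv := by
  induction x with
  | h w hw =>
    rw [Projectivization.submodule_mk, Submodule.mem_span_singleton] at h
    obtain ⟨a, rfl⟩ := h
    have ha : a ≠ 0 := fun h => hv (by simp [h])
    refine (Projectivization.mk_eq_mk_iff' ℂ _ _ _ _).2 ⟨a⁻¹, ?_⟩
    rw [smul_smul, inv_mul_cancel₀ ha, one_smul]

theorem mem_submodule_mk {v : Cn n} (hv : v ≠ 0) : v ∈ (Projectivization.mk ℂ v hv).submodule := by
  rw [Projectivization.submodule_mk]
  exact Submodule.mem_span_singleton_self v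

instance : T2Space (ℙ ℂ (Cn n)) := by
  refine ⟨fun x y hxy => ?_⟩
  -- a coordinate in which both points are nonzero gives a separating function
  by_cases h : ∃ i, x.rep i ≠ 0 ∧ y.rep i ≠ 0
  · obtain ⟨i, hx, hy⟩ := h
    have : ∃ j, x.rep j / x.rep i ≠ y.rep j / y.rep i := by
      by_contra! hc
      refine hxy ?_
      rw [← x.mk_rep, ← y.mk_rep]
      refine (Projectivization.mk_eq_mk_iff' ℂ _ _ _ _).2 ⟨x.rep i / y.rep i, ?_⟩
      ext j
      have := hc j
      simp only [PiLp.smul_apply, smul_eq_mul]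
      field_simp at this ⊢
      linear_combination -this
    obtain ⟨j, hj⟩ := this
    obtain ⟨u, v, hu, hv, hxu, hyv, huv⟩ := t2_separation hj
    exact ⟨_, _, (continuousOn_rep_div i j).isOpen_inter_preimage (isOpen_rep_ne i) hu,
      (continuousOn_rep_div i j).isOpen_inter_preimage (isOpen_rep_ne i) hv,
      ⟨hx, hxu⟩, ⟨hy, hyv⟩,
      (huv.preimage _).mono inter_subset_right inter_subset_right⟩
  · -- otherwise compare the sizes of two coordinates
    push Not at h
    obtain ⟨i, hi⟩ : ∃ i, x.rep i ≠ 0 := by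
      by_contra! hc
      exact x.rep_nonzero (by ext i; exact hc i)
    obtain ⟨j, hj⟩ : ∃ j, y.rep j ≠ 0 := by
      by_contra! hc
      exact y.rep_nonzero (by ext i; exact hc i)
    have hyi : y.rep i = 0 := h i hi
    have hxj : x.rep j = 0 := by
      by_contra hc
      exact hj (h j hc)
    refine ⟨_, _,
      ((continuousOn_rep_div i j).norm).isOpen_inter_preimage (isOpen_rep_ne i)
        (isOpen_Iio (a := (1 : ℝ))),
      ((continuousOn_rep_div j i).norm).isOpen_inter_preimage (isOpen_rep_ne j)
        (isOpen_Iio (a := (1 : ℝ))), ⟨hi, by simp [hxj]⟩, ⟨hj, by simp [hyi]⟩, ?_⟩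
    rw [Set.disjoint_left]
    rintro z ⟨hzi, hz1⟩ ⟨hzj, hz2⟩
    simp only [mem_ofPred_eq, mem_preimage, mem_Iio, norm_div] at hzi hzj hz1 hz2
    have h1 := norm_pos_iff.2 hzi
    have h2 := norm_pos_iff.2 hzj
    rw [div_lt_one h1] at hz1
    rw [div_lt_one h2] at hz2
    linarith

instance : SecondCountableTopology (ℙ ℂ (Cn n)) :=
  isOpenQuotientMap_mk'.isQuotientMap.secondCountableTopology isOpenQuotientMap_mk'.isOpenMap

end Proj

/-! ### The blowup of `ℂⁿ` along a closed discrete subset -/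

/-- The blowup of `ℂⁿ` along a closed discrete set `D`, as an incidence variety: a point `z` of `ℂⁿ`
together with, for every `d ∈ D`, a line `ℓ d` through the origin that contains `z - d`. (It is the
fibre product over `ℂⁿ` of the blowups at the single points `d ∈ D`.) The line `ℓ d` is determined
by `z` if `z ≠ d`, and ranges over the projective space of all lines if `z = d`. The topology is the
subspace topology. -/
def Blowup {n : ℕ} (D : Set (Cn n)) (_hD : IsClosed D ∧ IsDiscrete D) : Type :=
  {p : Cn n × (D → ℙ ℂ (Cn n)) // ∀ d : D, p.1 - d ∈ (p.2 d).submodule}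

namespace Blowup

variable {n : ℕ} {D : Set (Cn n)} {hD : IsClosed D ∧ IsDiscrete D}

instance : TopologicalSpace (Blowup D hD) := inferInstanceAs (TopologicalSpace (Subtype _))

/-- The blow-down map. -/
def proj (p : Blowup D hD) : Cn n := p.1.1

/-- The line at `d`. -/
def line (p : Blowup D hD) (d : D) : ℙ ℂ (Cn n) := p.1.2 d

theorem continuous_proj : Continuous (proj : Blowup D hD → Cn n) :=
  continuous_fst.comp continuous_subtype_val

theorem continuous_line (d : D) : Continuous (fun p : Blowup D hD => p.line d) :=
  (continuous_apply d).comp (continuous_snd.comp continuous_subtype_val)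

theorem sub_mem (p : Blowup D hD) (d : D) : p.proj - d ∈ (p.line d).submodule := p.2 d

@[ext]
theorem ext {p q : Blowup D hD} (h1 : p.proj = q.proj) (h2 : ∀ d, p.line d = q.line d) : p = q :=
  Subtype.ext (Prod.ext h1 (funext h2))

theorem line_eq (p : Blowup D hD) (d : D) (h : p.proj - d ≠ 0) :
    p.line d = Projectivization.mk ℂ (p.proj - d) h :=
  Proj.mk_eq_of_mem h (p.sub_mem d)

theorem continuousOn_iff {X : Type*} [TopologicalSpace X] {s : Set X} {f : X → Blowup D hD} :
    ContinuousOn f s ↔ ContinuousOn (fun x => (f x).proj) s ∧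
      ∀ d, ContinuousOn (fun x => (f x).line d) s := by
  constructor
  · exact fun h => ⟨continuous_proj.comp_continuousOn h,
      fun d => (continuous_line d).comp_continuousOn h⟩
  · rintro ⟨h1, h2⟩
    have hi : Topology.IsInducing (fun p : Blowup D hD => p.1) := Topology.IsInducing.subtypeVal
    exact hi.continuousOn_iff.2 (h1.prodMk (continuousOn_pi.2 h2))

instance : T2Space (Blowup D hD) := inferInstanceAs (T2Space (Subtype _))

theorem countable (hD : IsClosed D ∧ IsDiscrete D) : Countable D := by
  have := hD.2.to_subtype
  exact countable_of_Lindelof_of_discrete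

instance : SecondCountableTopology (Blowup D hD) :=
  have := countable hD
  have hi : Topology.IsInducing (fun p : Blowup D hD => p.1) := Topology.IsInducing.subtypeVal
  hi.secondCountableTopology

theorem isClosed_diff (hD : IsClosed D ∧ IsDiscrete D) (d : D) : IsClosed (D \ {d.1}) := by
  obtain ⟨U, hU, h⟩ := isOpen_inter_eq_singleton_of_mem_discrete hD.2 d.2
  have : D \ {d.1} = D ∩ Uᶜ := by
    rw [← h]
    ext x
    simp
  rw [this]
  exact hD.1.inter hU.isClosed_compl

/-- The inverse of the blow-down map off `D` (with an arbitrary value on `D`). -/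
def lift [Nonempty (Blowup D hD)] (z : Cn n) : Blowup D hD :=
  open Classical in
  if hz : z ∈ D then Classical.arbitrary _
  else ⟨(z, fun d => Projectivization.mk ℂ (z - d)
      (sub_ne_zero.2 fun h => hz (h ▸ d.2))), fun _ => Proj.mem_submodule_mk _⟩

theorem proj_lift [Nonempty (Blowup D hD)] {z : Cn n} (hz : z ∉ D) :
    (lift z : Blowup D hD).proj = z := by
  simp [lift, hz, proj]

/-- The chart given by the blow-down map on the complement of the exceptional set. -/
def baseChart [Nonempty (Blowup D hD)] : OpenPartialHomeomorph (Blowup D hD) (Cn n) where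
  toFun := proj
  invFun := lift
  source := {p | p.proj ∉ D}
  target := Dᶜ
  map_source' := fun _ hp => hp
  map_target' := fun z hz => by
    rw [mem_ofPred_eq, proj_lift hz]
    exact hz
  left_inv' := fun p hp => by
    have h := proj_lift (hD := hD) hp
    refine ext h fun d => ?_
    have h0 : p.proj - d ≠ 0 := sub_ne_zero.2 fun h => hp (h ▸ d.2)
    rw [line_eq p d h0, line_eq _ d (by rwa [h])]
    congr 2
  right_inv' := fun _ hz => proj_lift hz
  open_source := hD.1.isOpen_compl.preimage continuous_proj
  open_target := hD.1.isOpen_compl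
  continuousOn_toFun := continuous_proj.continuousOn
  continuousOn_invFun := by
    rw [continuousOn_iff]
    refine ⟨continuousOn_id.congr fun z hz => proj_lift hz, fun d => ?_⟩
    have h0 : ∀ z ∈ Dᶜ, z - d.1 ≠ 0 := fun z hz => sub_ne_zero.2 fun h => hz (h ▸ d.2)
    refine Proj.continuousOn_mk (f := fun z => z - d.1) (by fun_prop) h0 fun z hz => ?_
    rw [line_eq _ d (by rw [proj_lift hz]; exact h0 z hz)]
    congr 2
    exact proj_lift hz

/-- The vector `(w₁, …, 1, …, wₙ)` with `1` in place of `wᵢ`. -/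
def dir (i : Fin n) (w : Cn n) : Cn n := WithLp.toLp 2 fun j => if j = i then 1 else w j

theorem dir_self (i : Fin n) (w : Cn n) : dir i w i = 1 := by simp [dir]

theorem dir_ne_zero (i : Fin n) (w : Cn n) : dir i w ≠ 0 := fun h => by
  simpa [h] using dir_self i w

/-- The blow-down map in the affine coordinates number `i` at `d`:
`w ↦ d + (wᵢw₁, …, wᵢ, …, wᵢwₙ)`. -/
def center (d : D) (i : Fin n) (w : Cn n) : Cn n := d + w i • dir i w

theorem contDiff_dir (i : Fin n) : ContDiff ℂ ω (dir i) := by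
  rw [contDiff_euclidean]
  intro j
  by_cases h : j = i
  · simp only [dir, h, if_true]
    exact contDiff_const
  · simp only [dir, h, if_false]
    exact contDiff_piLp_apply 2

theorem contDiff_center (d : D) (i : Fin n) : ContDiff ℂ ω (center d i) := by
  unfold center
  exact contDiff_const.add ((contDiff_piLp_apply 2).smul (contDiff_dir i))

/-- The affine coordinates number `i` at `d`: the `i`-th one is `zᵢ - dᵢ`, and the others are the
ratios `ℓⱼ / ℓᵢ` of the homogeneous coordinates of the line `ℓ` at `d`. -/
def coord (d : D) (i : Fin n) (p : Blowup D hD) : Cn n :=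
  WithLp.toLp 2 fun j => if j = i then p.proj i - d.1 i else (p.line d).rep j / (p.line d).rep i

/-- The point with affine coordinates `w`. -/
def ofCoord (d : D) (i : Fin n) (w : Cn n) : Blowup D hD :=
  open Classical in
  ⟨(center d i w, fun d' => if h : d' ≠ d ∧ center d i w - d' ≠ 0 then
      Projectivization.mk ℂ (center d i w - d') h.2
    else Projectivization.mk ℂ (dir i w) (dir_ne_zero i w)), fun d' => by
      by_cases h : d' ≠ d ∧ center d i w - d' ≠ 0
      · simp only [dif_pos h]
        exact Proj.mem_submodule_mk _
      · simp only [dif_neg h]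
        by_cases h1 : d' = d
        · subst h1
          rw [center, add_sub_cancel_left]
          exact Submodule.smul_mem _ _ (Proj.mem_submodule_mk _)
        · have : center d i w - d' = 0 := by
            by_contra h2
            exact h ⟨h1, h2⟩
          rw [this]
          exact Submodule.zero_mem _⟩

theorem proj_ofCoord (d : D) (i : Fin n) (w : Cn n) :
    (ofCoord d i w : Blowup D hD).proj = center d i w := rfl

theorem line_ofCoord (d : D) (i : Fin n) (w : Cn n) :
    (ofCoord d i w : Blowup D hD).line d = Projectivization.mk ℂ (dir i w) (dir_ne_zero i w) := by
  simp [ofCoord, line]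

theorem dir_coord (d : D) (i : Fin n) (p : Blowup D hD) (h : (p.line d).rep i ≠ 0) :
    dir i (coord d i p) = ((p.line d).rep i)⁻¹ • (p.line d).rep := by
  ext j
  by_cases hj : j = i
  · subst hj
    simp [dir, coord, h]
  · simp [dir, coord, hj, div_eq_inv_mul]

theorem center_coord (d : D) (i : Fin n) (p : Blowup D hD) (h : (p.line d).rep i ≠ 0) :
    center d i (coord d i p) = p.proj := by
  have h1 := p.sub_mem d
  rw [Projectivization.submodule_eq, Submodule.mem_span_singleton] at h1
  obtain ⟨a, ha⟩ := h1
  have h2 : p.proj = d + a • (p.line d).rep := by rw [ha]; abel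
  rw [center, dir_coord d i p h]
  have h3 : coord d i p i = a * (p.line d).rep i := by
    simp only [coord, if_true]
    rw [h2]
    simp
  rw [h3, smul_smul, mul_assoc, mul_inv_cancel₀ h, mul_one, ← h2]

theorem coord_ofCoord (d : D) (i : Fin n) (w : Cn n) :
    coord d i (ofCoord d i w : Blowup D hD) = w := by
  ext j
  by_cases hj : j = i
  · subst hj
    simp [coord, proj_ofCoord, center, dir]
  · simp only [coord, hj, if_false, line_ofCoord, Proj.rep_mk_div, dir_self]
    simp [dir, hj]

/-- The affine chart number `i` at `d ∈ D`. Its domain is the set of points that do not lie over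
other points of `D`, and whose line at `d` has nonzero `i`-th homogeneous coordinate. -/
def affineChart (d : D) (i : Fin n) : OpenPartialHomeomorph (Blowup D hD) (Cn n) where
  toFun := coord d i
  invFun := ofCoord d i
  source := {p | p.proj ∉ D \ {d.1} ∧ (p.line d).rep i ≠ 0}
  target := {w | center d i w ∉ D \ {d.1}}
  map_source' := fun p hp => by
    rw [mem_ofPred_eq, center_coord d i p hp.2]
    exact hp.1
  map_target' := fun w hw => by
    refine ⟨hw, ?_⟩
    rw [line_ofCoord, Proj.rep_mk_ne, dir_self]
    exact one_ne_zero
  left_inv' := fun p hp => by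
    have hc : (ofCoord d i (coord d i p) : Blowup D hD).proj = p.proj := center_coord d i p hp.2
    refine ext hc fun d' => ?_
    by_cases h : d' = d
    · subst h
      rw [line_ofCoord]
      refine (Proj.mk_eq_of_mem _ ?_).symm
      rw [dir_coord d' i p hp.2, Projectivization.submodule_eq]
      exact Submodule.smul_mem _ _ (Submodule.mem_span_singleton_self _)
    · have h0 : p.proj - d' ≠ 0 := fun h0 => hp.1 <| by
        rw [sub_eq_zero.1 h0]
        exact ⟨d'.2, fun h1 => h (Subtype.ext h1)⟩
      rw [line_eq p d' h0, line_eq _ d' (by rwa [hc])]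
      congr 2
  right_inv' := fun w _ => coord_ofCoord d i w
  open_source := ((isClosed_diff hD d).isOpen_compl.preimage continuous_proj).inter
    ((Proj.isOpen_rep_ne i).preimage (continuous_line d))
  open_target := (isClosed_diff hD d).isOpen_compl.preimage (contDiff_center d i).continuous
  continuousOn_toFun := by
    refine (PiLp.continuous_toLp 2 _).comp_continuousOn (continuousOn_pi.2 fun j => ?_)
    by_cases hj : j = i
    · simp only [hj, if_true]
      have := continuous_proj (hD := hD)
      fun_prop
    · simp only [hj, if_false]
      exact (Proj.continuousOn_rep_div i j).comp (continuous_line d).continuousOn fun p hp => hp.2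
  continuousOn_invFun := by
    rw [continuousOn_iff]
    refine ⟨(contDiff_center d i).continuous.continuousOn, fun d' => ?_⟩
    by_cases h : d' = d
    · subst h
      exact Proj.continuousOn_mk (contDiff_dir i).continuous.continuousOn
        (fun w _ => dir_ne_zero i w) fun w _ => line_ofCoord d' i w
    · have h0 : ∀ w ∈ {w | center d i w ∉ D \ {d.1}}, center d i w - d' ≠ 0 := fun w hw h0 =>
        hw <| by
          rw [sub_eq_zero.1 h0]
          exact ⟨d'.2, fun h1 => h (Subtype.ext h1)⟩
      exact Proj.continuousOn_mk
        ((contDiff_center d i).continuous.sub continuous_const).continuousOn h0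
        fun w hw => line_eq (ofCoord d i w : Blowup D hD) d' (h0 w hw)

/-- The complex structure of the blowup: the blow-down map off the exceptional set and the affine
charts at the points of `D` are charts. -/
instance : ChartedSpace (Cn n) (Blowup D hD) where
  atlas := {e | (∃ h : Nonempty (Blowup D hD), e = @baseChart n D hD h) ∨
    ∃ d i, e = affineChart d i}
  chartAt p :=
    open Classical in
    if h : ∃ e : D × Fin n, p ∈ (affineChart e.1 e.2 : OpenPartialHomeomorph (Blowup D hD) _).source
    then affineChart h.choose.1 h.choose.2 else @baseChart n D hD ⟨p⟩
  mem_chart_source p := by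
    split_ifs with h
    · exact h.choose_spec
    · change p.proj ∉ D
      intro hp
      obtain ⟨i, hi⟩ : ∃ i, (p.line ⟨_, hp⟩).rep i ≠ 0 := by
        by_contra! hc
        exact (p.line ⟨_, hp⟩).rep_nonzero (by ext i; exact hc i)
      exact h ⟨(⟨_, hp⟩, i), by simp, hi⟩
  chart_mem_atlas p := by
    split_ifs with h
    · exact Or.inr ⟨_, _, rfl⟩
    · exact Or.inl ⟨_, rfl⟩

theorem contDiffOn_coord {s : Set (Cn n)} {g : Cn n → Blowup D hD} (d : D) (i : Fin n)
    (hg : ContDiffOn ℂ ω (fun w => (g w).proj) s) {v : Cn n → Cn n} (hv : ContDiffOn ℂ ω v s)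
    (hv0 : ∀ w, w ∈ s → v w ≠ 0) (hv1 : ∀ w, w ∈ s → v w ∈ ((g w).line d).submodule)
    (hs : ∀ w, w ∈ s → ((g w).line d).rep i ≠ 0) :
    ContDiffOn ℂ ω (fun w => coord d i (g w)) s := by
  rw [contDiffOn_euclidean]
  intro j
  by_cases hj : j = i
  · simp only [coord, hj, if_true]
    exact (contDiffOn_euclidean.1 hg i).sub contDiffOn_const
  · simp only [coord, hj, if_false]
    refine ((contDiffOn_euclidean.1 hv j).div (contDiffOn_euclidean.1 hv i) fun w hw => ?_).congr
      fun w hw => ?_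
    · have := hs w hw
      rwa [Proj.mk_eq_of_mem (hv0 w hw) (hv1 w hw), Proj.rep_mk_ne] at this
    · rw [Proj.mk_eq_of_mem (hv0 w hw) (hv1 w hw), Proj.rep_mk_div]
      rfl

instance : IsManifold 𝓘(ℂ, Cn n) ω (Blowup D hD) := by
  refine isManifold_of_contDiffOn _ _ _ fun e e' he he' => ?_
  simp only [modelWithCornersSelf_coe, modelWithCornersSelf_coe_symm, Function.comp_id,
    Function.id_comp, preimage_id, range_id, inter_univ]
  rcases he with ⟨h, rfl⟩ | ⟨d, i, rfl⟩ <;> rcases he' with ⟨h', rfl⟩ | ⟨d', i', rfl⟩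
  · exact contDiffOn_id.congr fun z hz => proj_lift hz.1
  · have hp : ∀ z, z ∈ (baseChart.symm ≫ₕ (affineChart d' i' :
        OpenPartialHomeomorph (Blowup D hD) _)).source → (lift z : Blowup D hD).proj = z :=
      fun z hz => proj_lift hz.1
    refine contDiffOn_coord (g := lift) d' i' (contDiffOn_id.congr hp)
      (v := fun z => z - d') (contDiffOn_id.sub contDiffOn_const)
      (fun z hz => sub_ne_zero.2 fun h => hz.1 (h ▸ d'.2)) (fun z hz => ?_) fun z hz => hz.2.2
    have := (lift z : Blowup D hD).sub_mem d'
    rwa [hp z hz] at this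
  · exact (contDiff_center d i).contDiffOn
  · by_cases hd : d' = d
    · subst hd
      exact contDiffOn_coord (g := ofCoord d' i) d' i' (contDiff_center d' i).contDiffOn
        (contDiff_dir i).contDiffOn (fun w _ => dir_ne_zero i w)
        (fun w _ => by rw [line_ofCoord]; exact Proj.mem_submodule_mk _) fun w hw => hw.2.2
    · refine contDiffOn_coord (g := ofCoord d i) d' i' (contDiff_center d i).contDiffOn
        (v := fun w => center d i w - d') ((contDiff_center d i).contDiffOn.sub contDiffOn_const)
        (fun w hw h0 => ?_) (fun w _ => sub_mem _ d') fun w hw => hw.2.2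
      refine hw.1 ?_
      rw [sub_eq_zero.1 h0]
      exact ⟨d'.2, fun h1 => hd (Subtype.ext h1)⟩

theorem dense_compl_exceptional : Dense {p : Blowup D hD | p.proj ∉ D} := by
  intro p
  by_cases hp : p.proj ∈ D
  swap
  · exact subset_closure hp
  set d : D := ⟨p.proj, hp⟩ with hd
  obtain ⟨i, hi⟩ : ∃ i, (p.line d).rep i ≠ 0 := by
    by_contra! hc
    exact (p.line d).rep_nonzero (by ext i; exact hc i)
  set e : OpenPartialHomeomorph (Blowup D hD) (Cn n) := affineChart d i with he
  have hps : p ∈ e.source := ⟨by simp [hd], hi⟩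
  have hc : ContinuousAt e.symm (e p) := e.continuousAt_symm (e.map_source hps)
  -- approach `p` along the line `w + t eᵢ` in the affine chart
  let c : ℂ → Cn n := fun t => e p + t • EuclideanSpace.single i (1 : ℂ)
  have hcc : Continuous c := by fun_prop
  have hc0 : c 0 = e p := by simp [c]
  have ht : Filter.Tendsto (fun t => e.symm (c t)) (𝓝[≠] 0) (𝓝 p) := by
    have h1 : Filter.Tendsto c (𝓝[≠] 0) (𝓝 (e p)) := by
      rw [← hc0]
      exact hcc.continuousAt.tendsto.mono_left nhdsWithin_le_nhds
    have := hc.tendsto.comp h1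
    rwa [e.left_inv hps] at this
  refine mem_closure_of_tendsto ht ?_
  have hev : ∀ᶠ t in 𝓝[≠] (0 : ℂ), c t ∈ e.target :=
    nhdsWithin_le_nhds (hcc.continuousAt.preimage_mem_nhds
      (e.open_target.mem_nhds (by rw [hc0]; exact e.map_source hps)))
  filter_upwards [hev, self_mem_nhdsWithin] with t ht1 ht2
  change center d i (c t) ∉ D
  intro hmem
  refine ht1 ⟨hmem, fun h => ht2 ?_⟩
  have h2 : (c t) i • dir i (c t) = 0 := by
    have : center d i (c t) = d := h
    rwa [center, add_eq_left] at this
  have h3 : (c t) i = 0 := (smul_eq_zero.1 h2).resolve_right (dir_ne_zero _ _)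
  have h4 : (e p) i = 0 := by
    change coord d i p i = 0
    simp [coord, hd]
  simpa [c, h4] using h3

/-- In dimension at least two the blowup is a (connected) complex manifold. -/
theorem isComplexManifold (hn : 1 < n) : IsComplexManifold n (Blowup D hD) where
  isManifold := inferInstance
  t2 := inferInstance
  secondCountable := inferInstance
  connected := by
    have hc : IsConnected Dᶜ := by
      refine ((Set.countable_coe_iff.1 (countable hD)).isPathConnected_compl_of_one_lt_rank
        ?_).isConnected
      rw [rank_real_of_complex]
      simp only [rank_eq_card_basis (EuclideanSpace.basisFun (Fin n) ℂ).toBasis, Fintype.card_fin]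
      norm_cast
      omega
    have hne : Nonempty (Blowup D hD) := by
      obtain ⟨z, hz⟩ := hc.nonempty
      exact ⟨⟨(z, fun d => Projectivization.mk ℂ (z - d)
        (sub_ne_zero.2 fun h => hz (h ▸ d.2))), fun _ => Proj.mem_submodule_mk _⟩⟩
    have h1 : IsConnected {p : Blowup D hD | p.proj ∉ D} := by
      have := hc.image _ (baseChart (hD := hD)).continuousOn_symm
      have h2 := (baseChart (hD := hD)).symm.image_source_eq_target
      rw [OpenPartialHomeomorph.symm_source, OpenPartialHomeomorph.symm_target] at h2
      change IsConnected ((baseChart (hD := hD)).symm '' (baseChart (hD := hD)).target) at this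
      rwa [h2] at this
    have := h1.closure
    rw [dense_compl_exceptional.closure_eq] at this
    exact connectedSpace_iff_univ.2 this

end Blowup

end

/-!
A holomorphic map `f` from `ℂⁿ` to the blowup is studied through the entire map `F = proj ∘ f`. In
the affine charts the blow-down map contracts the exceptional divisor, so `F` is degenerate,
`det F' = 0`, wherever it meets `D` (`Blowup.det_fderiv_proj_comp_eq_zero`, which needs `n > 1`).
The set `D` is chosen, in the manner of Rosay and Rudin, such that every entire map of `ℂⁿ` that is
nondegenerate somewhere hits `D` at a point where it is nondegenerate
(`exists_isClosed_isDiscrete_forall_exists_mem_det_fderiv_ne_zero`). Hence `det F'` vanishes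
identically for every `f`. So no `f` is locally biholomorphic anywhere, and the inverse of the
blow-down map on a ball off `D` is not a limit of such maps, which refutes the Oka property.

The set `D` is a union of finite sets. Normalized entire maps whose maximum modulus is at least `r`
on the unit ball and at most `r + 1` on a slightly larger ball cover balls of a uniform size near
the sphere of radius `r`, by a quantitative inverse function theorem and a quantitative identity
theorem for the determinant, so that a finite net meets all their images
(`exists_finite_forall_exists_mem_det_fderiv_ne_zero`). A growth lemma of Borel type rescales any
nondegenerate entire map into one of countably many such classes
(`exists_norm_le_and_forall_norm_le`).

That `ℂⁿ` is Oka is Runge approximation on convex compact sets. A function `f` holomorphic near a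
compact set `K` that is star-shaped about `0` is deformed through `z ↦ f (t z)`, which is entire for
`t = 0`; the property that all such functions are limits of entire ones propagates in `t` by Taylor
expansion, with uniform step (`isEntirelyApproximable_of_starConvex_zero`).

The graph of the blow-down map is a bimeromorphic correspondence: the blow-down map is proper since
projective space is compact, and biholomorphic off `D` (`Blowup.isBimeromorphic`).
-/

/-! ### Quantitative lemmas on holomorphic maps -/

section UnavoidableSet

open Metric

variable {E : Type*} [NormedAddCommGroup E] [NormedSpace ℂ E]

/-- A quantitative identity theorem: an entire function that is bounded by `C` on the unit circle
and not small at the center is not small on the arc around `1`. The product of `h` with finitely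
many rotated copies of itself, such that some factor is small at each point of the circle, would
violate the maximum principle. The bound `η` does not depend on `h`. -/
theorem exists_norm_eq_one_of_norm_center_ge {C c ρ : ℝ} (hc : 0 < c) (hρ : 0 < ρ) :
    ∃ η > 0, ∀ h : ℂ → ℂ, Differentiable ℂ h → (∀ z, ‖z‖ = 1 → ‖h z‖ ≤ C) → c ≤ ‖h 0‖ →
      ∃ z : ℂ, ‖z‖ = 1 ∧ ‖z - 1‖ < ρ ∧ η ≤ ‖h z‖ := by
  -- `t` collects the rotations: each point of the circle is `ρ`-close to some `μ ∈ t`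
  obtain ⟨t, ht, htf, hcov⟩ := (isCompact_sphere (0 : ℂ) 1).finite_cover_balls hρ
  lift t to Finset ℂ using htf
  have ht1 : ∀ μ ∈ t, ‖μ‖ = 1 := fun μ hμ => by simpa using ht hμ
  set C' := max C 1 with hC'
  have hC1 : 1 ≤ C' := le_max_right _ _
  set m := t.card
  refine ⟨c ^ m / (2 * C' ^ (m - 1)), by positivity, fun h hh hC h0 => ?_⟩
  by_contra! hcon
  set η := c ^ m / (2 * C' ^ (m - 1)) with hη
  have hη0 : 0 < η := by positivity
  have hd : Differentiable ℂ fun z => ∏ μ ∈ t, h (z * μ⁻¹) := by fun_prop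
  have hbd : ∀ z ∈ frontier (ball (0 : ℂ) 1),
      ‖∏ μ ∈ t, h (z * μ⁻¹)‖ ≤ η * C' ^ (m - 1) := by
    intro z hz
    rw [frontier_ball _ one_ne_zero] at hz
    obtain ⟨μ, hμ, hzμ⟩ := mem_iUnion₂.1 (hcov hz)
    have hz1 : ‖z‖ = 1 := by simpa using hz
    have hμ0 : μ ≠ 0 := fun h => by simpa [h] using ht1 μ hμ
    rw [norm_prod, ← Finset.mul_prod_erase t _ hμ]
    have h1 : ‖h (z * μ⁻¹)‖ ≤ η := by
      refine (hcon _ (by simp [hz1, ht1 μ hμ]) ?_).le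
      have : z * μ⁻¹ - 1 = (z - μ) * μ⁻¹ := by field_simp
      rw [this, norm_mul, norm_inv, ht1 μ hμ]
      simpa [dist_eq_norm] using hzμ
    have h2 : ∏ ν ∈ t.erase μ, ‖h (z * ν⁻¹)‖ ≤ C' ^ (m - 1) := by
      rw [← Finset.card_erase_of_mem hμ, ← Finset.prod_const]
      refine Finset.prod_le_prod (fun _ _ => norm_nonneg _) fun ν hν => ?_
      exact (hC _ (by simp [hz1, ht1 ν (Finset.mem_of_mem_erase hν)])).trans (le_max_left _ _)
    gcongr
  have := Complex.norm_le_of_forall_mem_frontier_norm_le isBounded_ball hd.diffContOnCl hbd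
    (subset_closure (mem_ball_self one_pos))
  simp only [zero_mul, Finset.prod_const, norm_pow] at this
  have h3 : c ^ m ≤ ‖h 0‖ ^ m := by gcongr
  have h4 : η * C' ^ (m - 1) = c ^ m / 2 := by
    rw [hη]; field_simp
  have h5 : 0 < c ^ m := by positivity
  change ‖h 0‖ ^ m ≤ _ at this
  linarith

theorem contDiff_continuousLinearMap_det [FiniteDimensional ℂ E] {k : WithTop ℕ∞} :
    ContDiff ℂ k fun A : E →L[ℂ] E => A.det := by
  let b := Module.finBasis ℂ E
  have : (fun A : E →L[ℂ] E => A.det) = fun A => ∑ σ : Equiv.Perm (Fin (Module.finrank ℂ E)),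
      Equiv.Perm.sign σ • ∏ i, (b.coord (σ i)).toContinuousLinearMap (A (b i)) := by
    ext A
    rw [ContinuousLinearMap.det, ← LinearMap.det_toMatrix b, Matrix.det_apply]
    simp [LinearMap.toMatrix_apply]
  rw [this]
  refine ContDiff.sum fun σ _ => ContDiff.const_smul _ (contDiff_prod fun i _ => ?_)
  fun_prop

/-- The inverses of the operators with `‖A‖ ≤ L` and `|det A| ≥ η` are uniformly bounded, as these
operators form a compact set. -/
theorem exists_norm_inverse_le [FiniteDimensional ℂ E] (L : ℝ) {η : ℝ} (hη : 0 < η) :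
    ∃ B > 0, ∀ A : E →L[ℂ] E, ‖A‖ ≤ L → η ≤ ‖A.det‖ →
      ∃ e : E ≃L[ℂ] E, (e : E →L[ℂ] E) = A ∧ ‖(e.symm : E →L[ℂ] E)‖ ≤ B := by
  have : CompleteSpace E := FiniteDimensional.complete ℂ E
  have : FiniteDimensional ℂ (E →L[ℂ] E) := inferInstance
  have : ProperSpace (E →L[ℂ] E) := FiniteDimensional.proper ℂ _
  set S : Set (E →L[ℂ] E) := closedBall 0 L ∩ {A | η ≤ ‖A.det‖} with hS
  have hSc : IsCompact S := (isCompact_closedBall _ _).inter_right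
    (isClosed_le continuous_const (contDiff_continuousLinearMap_det (k := 0)).continuous.norm)
  have hun : ∀ A ∈ S, ∃ e : E ≃L[ℂ] E, (e : E →L[ℂ] E) = A := fun A hA => by
    have h0 : A.det ≠ 0 := norm_pos_iff.1 (hη.trans_le hA.2)
    exact ⟨A.toContinuousLinearEquivOfDetNeZero h0, by ext; simp⟩
  have hco : ContinuousOn (fun A : E →L[ℂ] E => Ring.inverse A) S := fun A hA => by
    obtain ⟨e, rfl⟩ := hun A hA
    exact (NormedRing.inverse_continuousAt
      (ContinuousLinearEquiv.unitsEquiv ℂ E |>.symm e)).continuousWithinAt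
  obtain ⟨B, hB⟩ := hSc.exists_bound_of_continuousOn hco
  refine ⟨max B 1, by positivity, fun A hA1 hA2 => ?_⟩
  have hA : A ∈ S := ⟨by simpa using hA1, hA2⟩
  obtain ⟨e, rfl⟩ := hun A hA
  refine ⟨e, rfl, le_max_of_le_left ?_⟩
  have h := hB _ hA
  have h1 : Ring.inverse (e : E →L[ℂ] E) = e.symm :=
    Ring.inverse_unit (ContinuousLinearEquiv.unitsEquiv ℂ E |>.symm e)
  rwa [h1] at h

theorem det_ne_zero_of_norm_sub_lt {A : E →L[ℂ] E} [FiniteDimensional ℂ E] {e : E ≃L[ℂ] E} {B : ℝ}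
    (hB : ‖(e.symm : E →L[ℂ] E)‖ ≤ B) (h : B * ‖A - e‖ < 1) : A.det ≠ 0 := by
  intro hA
  obtain ⟨v, hv, hv0⟩ := (Submodule.ne_bot_iff _).1
    (LinearMap.bot_lt_ker_of_det_eq_zero (f := (A : E →ₗ[ℂ] E)) hA).ne'
  replace hv : A v = 0 := hv
  have h1 : v = (e.symm : E →L[ℂ] E) (-((A - e) v)) := by simp [hv]
  have h2 : ‖v‖ ≤ B * (‖A - e‖ * ‖v‖) := by
    conv_lhs => rw [h1]
    refine (ContinuousLinearMap.le_of_opNorm_le _ hB _).trans ?_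
    rw [norm_neg]
    gcongr
    · exact (norm_nonneg _).trans hB
    · exact ContinuousLinearMap.le_opNorm _ _
  have h3 : 0 < ‖v‖ := norm_pos_iff.2 hv0
  nlinarith

/-- A quantitative inverse function theorem: the radius `σ` of a ball covered by `G` near `z₀`, at
nondegenerate points, depends only on the bounds for the derivative of `G`. -/
theorem exists_closedBall_subset_image [FiniteDimensional ℂ E] {L η ρ : ℝ} (hL : 0 < L)
    (hη : 0 < η) (hρ : 0 < ρ) :
    ∃ σ > 0, ∀ (G : E → E) (z₀ : E), Differentiable ℂ G →
      (∀ z ∈ closedBall z₀ ρ, ‖fderiv ℂ G z - fderiv ℂ G z₀‖ ≤ L * ‖z - z₀‖) →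
      ‖fderiv ℂ G z₀‖ ≤ L → η ≤ ‖(fderiv ℂ G z₀).det‖ →
      ∀ w ∈ closedBall (G z₀) σ, ∃ z, G z = w ∧ (fderiv ℂ G z).det ≠ 0 := by
  have : CompleteSpace E := FiniteDimensional.complete ℂ E
  obtain ⟨B, hB0, hB⟩ := exists_norm_inverse_le (E := E) L hη
  obtain ⟨τ, hτ0, hτρ, hτ⟩ : ∃ τ > 0, τ ≤ ρ ∧ B * (L * τ) ≤ 1 / 2 :=
    ⟨min ρ (1 / (2 * B * L)), by positivity, min_le_left _ _, by
      calc B * (L * min ρ (1 / (2 * B * L))) ≤ B * (L * (1 / (2 * B * L))) := by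
            gcongr; exact min_le_right _ _
        _ = 1 / 2 := by field_simp⟩
  refine ⟨(2 * B)⁻¹ * τ, by positivity, fun G z₀ hG hlip hA hdet w hw => ?_⟩
  obtain ⟨e, he, heB⟩ := hB _ hA hdet
  have hbd : ∀ z ∈ closedBall z₀ τ, ‖fderiv ℂ G z - e‖ ≤ L * τ := fun z hz => by
    rw [he]
    refine (hlip z (closedBall_subset_closedBall hτρ hz)).trans ?_
    gcongr
    simpa [dist_eq_norm] using hz
  have happ : ApproximatesLinearOn G (e : E →L[ℂ] E) (closedBall z₀ τ) ⟨L * τ, by positivity⟩ :=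
    fun x hx y hy => (convex_closedBall z₀ τ).norm_image_sub_le_of_norm_fderiv_le'
      (fun z _ => hG z) hbd hy hx
  -- `e.symm` with the bound `B` in place of its norm, which may vanish if `E` is trivial
  let inv : (e : E →L[ℂ] E).NonlinearRightInverse :=
    { toFun := e.symm
      nnnorm := ⟨B, hB0.le⟩
      bound' := fun y => (e.symm : E →L[ℂ] E).le_of_opNorm_le heB y
      right_inv' := fun y => e.apply_symm_apply y }
  have hσ : (2 * B)⁻¹ * τ ≤ ((inv.nnnorm : ℝ)⁻¹ - L * τ) * τ := by
    refine mul_le_mul_of_nonneg_right ?_ hτ0.le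
    change (2 * B)⁻¹ ≤ B⁻¹ - L * τ
    have : B⁻¹ * (B * (L * τ)) ≤ B⁻¹ * (1 / 2) := by gcongr
    rw [inv_mul_cancel_left₀ hB0.ne'] at this
    rw [mul_inv]
    linarith
  obtain ⟨z, hz, rfl⟩ := happ.surjOn_closedBall_of_nonlinearRightInverse inv hτ0.le subset_rfl
    (closedBall_subset_closedBall hσ hw)
  refine ⟨z, rfl, det_ne_zero_of_norm_sub_lt heB ?_⟩
  calc B * ‖fderiv ℂ G z - e‖ ≤ B * (L * τ) := by gcongr; exact hbd z hz
    _ < 1 := by linarith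

/-! ### A discrete set that nondegenerate entire maps cannot avoid -/

/-- A finite set that is hit, at nondegenerate points, by all maps in the normalized class of entire
maps `G` with `|det G'(0)| ≥ c` whose maximum modulus is at least `r` on the unit ball and at most
`r + 1` on the ball of radius `R > 1`. Cauchy's estimates bound the first two derivatives of `G`.
Near a point where `‖G‖ ≥ r`, the determinant is at some `z₀` bounded below by a constant
of the class, so the image of `G` contains a ball around `G z₀` of a radius that depends only on the
class, and a sufficiently fine net will do. -/
theorem exists_finite_forall_exists_mem_det_fderiv_ne_zero [FiniteDimensional ℂ E] {R c : ℝ}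
    (hR : 1 < R) (hc : 0 < c) {r : ℝ} (hr : 0 ≤ r) :
    ∃ t : Set E, t.Finite ∧ (∀ w ∈ t, r - 2 ≤ ‖w‖) ∧ ∀ G : E → E, ContDiff ℂ 2 G →
      (∀ z ∈ closedBall 0 R, ‖G z‖ ≤ r + 1) → (∃ z ∈ closedBall 0 1, r ≤ ‖G z‖) →
      c ≤ ‖(fderiv ℂ G 0).det‖ → ∃ z, G z ∈ t ∧ (fderiv ℂ G z).det ≠ 0 := by
  have : CompleteSpace E := FiniteDimensional.complete ℂ E
  have : ProperSpace E := FiniteDimensional.proper ℂ _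
  have : ProperSpace (E →L[ℂ] E) := FiniteDimensional.proper ℂ _
  obtain ⟨δ, hδ, rfl⟩ : ∃ δ > 0, R = 1 + (δ + δ) := ⟨(R - 1) / 2, by linarith, by ring⟩
  set L₁ := 2 * (r + 1) / δ with hL₁
  have hL₁0 : 0 < L₁ := by positivity
  set L := max L₁ (2 * L₁ / δ)
  obtain ⟨C, hC⟩ := (isCompact_closedBall (0 : E →L[ℂ] E) L₁).exists_bound_of_continuousOn
    (contDiff_continuousLinearMap_det (E := E) (k := 0)).continuous.continuousOn
  -- `‖G'‖ ≤ L₁` will hold, so that `G` varies by at most `1` over a distance `L₁⁻¹`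
  obtain ⟨η, hη, hcirc⟩ := exists_norm_eq_one_of_norm_center_ge (C := C) hc (inv_pos.2 hL₁0)
  obtain ⟨σ, hσ, hsurj⟩ := exists_closedBall_subset_image (E := E) (L := L)
    (lt_max_of_lt_left hL₁0) hη (half_pos hδ)
  obtain ⟨t, -, htf, hcov⟩ := (isCompact_closedBall (0 : E) (r + 1)).finite_cover_balls
    (lt_min hσ one_pos)
  refine ⟨t ∩ {w | r - 2 ≤ ‖w‖}, htf.inter_of_left _, fun w hw => hw.2, ?_⟩
  rintro G hG hGM ⟨z₁, hz₁, hz₁r⟩ hdet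
  have hGd : Differentiable ℂ G := hG.differentiable two_ne_zero
  have hGd' : Differentiable ℂ (fderiv ℂ G) :=
    (hG.fderiv_right (m := 1) (by norm_num)).differentiable one_ne_zero
  have hsub : ∀ z ∈ closedBall (0 : E) (1 + δ), ball z δ ⊆ closedBall 0 (1 + (δ + δ)) :=
    fun z hz => ball_subset_closedBall.trans (closedBall_subset_closedBall' (by
      rw [mem_closedBall] at hz; linarith))
  have hmaps : ∀ {F : Type _} [NormedAddCommGroup F] (g : E → F) (M : ℝ) (z : E),
      (∀ w ∈ ball z δ, ‖g w‖ ≤ M) → MapsTo g (ball z δ) (closedBall (g z) (2 * M)) :=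
    fun g M z h w hw => by
      rw [mem_closedBall, dist_eq_norm]
      refine (norm_sub_le _ _).trans ?_
      linarith [h w hw, h z (mem_ball_self hδ)]
  have hG1 : ∀ z ∈ closedBall (0 : E) (1 + δ), ‖fderiv ℂ G z‖ ≤ L₁ := fun z hz =>
    Complex.norm_fderiv_le_div_of_mapsTo_ball hGd.differentiableOn
      (hmaps G _ z fun w hw => hGM w (hsub z hz hw)) hδ
  have h1δ : closedBall (0 : E) 1 ⊆ closedBall 0 (1 + δ) :=
    closedBall_subset_closedBall (by linarith)
  have hG2 : ∀ z ∈ closedBall (0 : E) 1, ∀ w ∈ closedBall z (δ / 2),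
      ‖fderiv ℂ G w - fderiv ℂ G z‖ ≤ L * ‖w - z‖ := fun z hz w hw => by
    have h := Complex.dist_le_div_mul_dist_of_mapsTo_ball hGd'.differentiableOn
      (hmaps (fderiv ℂ G) L₁ z fun w hw => hG1 w ?_)
      (closedBall_subset_ball (half_lt_self hδ) hw)
    · rw [dist_eq_norm, dist_eq_norm] at h
      refine h.trans ?_
      gcongr
      exact le_max_right _ _
    · exact closedBall_subset_closedBall' (by rw [mem_closedBall] at hz; linarith)
        (ball_subset_closedBall hw)
  obtain ⟨a, ha, ha1, haη⟩ := hcirc (fun a => (fderiv ℂ G (a • z₁)).det)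
    ((contDiff_continuousLinearMap_det (k := 1)).differentiable one_ne_zero |>.comp
      (hGd'.comp (by fun_prop)))
    (fun a ha => hC _ (by
      simpa using hG1 _ (h1δ (by simpa [norm_smul, ha] using hz₁)))) (by simpa using hdet)
  have hz₀ : a • z₁ ∈ closedBall (0 : E) 1 := by simpa [norm_smul, ha] using hz₁
  have hdist : ‖G (a • z₁) - G z₁‖ ≤ 1 := by
    have h := (convex_closedBall (0 : E) 1).norm_image_sub_le_of_norm_fderiv_le (𝕜 := ℂ)
      (fun z _ => hGd z) (fun z hz => hG1 z (h1δ hz)) hz₁ hz₀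
    refine h.trans ?_
    have h1 : ‖a • z₁ - z₁‖ ≤ L₁⁻¹ := by
      have h2 : a • z₁ - z₁ = (a - 1) • z₁ := by module
      rw [h2, norm_smul, ← mul_one L₁⁻¹]
      have : ‖z₁‖ ≤ 1 := by simpa using hz₁
      gcongr
    calc L₁ * ‖a • z₁ - z₁‖ ≤ L₁ * L₁⁻¹ := by gcongr
      _ = 1 := mul_inv_cancel₀ hL₁0.ne'
  have hz₀R : G (a • z₁) ∈ closedBall 0 (r + 1) := by
    simpa using hGM _ (closedBall_subset_closedBall (by linarith) hz₀)
  obtain ⟨w, hwt, hw⟩ := mem_iUnion₂.1 (hcov hz₀R)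
  rw [mem_ball, lt_min_iff] at hw
  obtain ⟨z, rfl, hz⟩ := hsurj G (a • z₁) hGd (hG2 _ hz₀)
    ((hG1 _ (h1δ hz₀)).trans (le_max_left _ _)) haη w (by
      rw [mem_closedBall, dist_comm]; exact hw.1.le)
  refine ⟨z, ⟨hwt, ?_⟩, hz⟩
  have h4 := norm_sub_norm_le (G z₁) (G (a • z₁))
  have h5 := norm_sub_norm_le (G (a • z₁)) (G z)
  rw [norm_sub_rev] at h4
  rw [dist_eq_norm] at hw
  change r - 2 ≤ ‖G z‖
  linarith [hw.2]

/-- A growth lemma of Borel type. The factors of the radius telescope: their product over all `k` is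
bounded by `2`. If the maximum modulus grew by `1` at each of these steps, it would be infinite at
a finite radius. -/
theorem exists_norm_le_and_forall_norm_le {E : Type*} [NormedAddCommGroup E] [ProperSpace E]
    {F : E → E} (hF : Continuous F)
    (hFu : ∀ M : ℝ, ∃ z, M ≤ ‖F z‖) (K : ℕ) :
    ∃ k ≥ K, ∃ s ≥ (1 : ℝ), (∃ z ∈ closedBall 0 s, (k : ℝ) ≤ ‖F z‖) ∧
      ∀ z ∈ closedBall 0 (s * ((2 - 1 / (k + 2)) / (2 - 1 / (k + 1)))), ‖F z‖ ≤ k + 1 := by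
  by_contra! hcon
  obtain ⟨z, hz⟩ := hFu K
  set s := max ‖z‖ 1
  have hS : ∀ k : ℕ, 1 ≤ 2 - 1 / ((k : ℝ) + 1) := fun k => by
    have : 1 / ((k : ℝ) + 1) ≤ 1 := by
      rw [div_le_one (by positivity)]
      linarith [(Nat.cast_nonneg k : (0 : ℝ) ≤ k)]
    linarith
  have hs1 : 1 ≤ s := le_max_right _ _
  have hind : ∀ k ≥ K, ∃ z ∈ closedBall (0 : E) (s * (2 - 1 / ((k : ℝ) + 1))),
      (k : ℝ) ≤ ‖F z‖ := by
    intro k hk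
    induction k, hk using Nat.le_induction with
    | base =>
      refine ⟨z, ?_, hz⟩
      rw [mem_closedBall_zero_iff]
      exact (le_max_left _ _).trans (le_mul_of_one_le_right (by positivity) (hS K))
    | succ k hk ih =>
      obtain ⟨z', hz', h⟩ := hcon k hk _ (one_le_mul_of_one_le_of_one_le hs1 (hS k)) ih
      have h0 := (one_pos.trans_le (hS k)).ne'
      refine ⟨z', ?_, by push_cast; exact h.le⟩
      rw [mul_assoc, mul_div_cancel₀ _ h0] at hz'
      push_cast
      convert hz' using 4
      ring
  obtain ⟨M, hM⟩ := (isCompact_closedBall (0 : E) (s * 2)).exists_bound_of_continuousOn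
    hF.continuousOn
  obtain ⟨k, hk⟩ := exists_nat_gt M
  obtain ⟨z', hz', h⟩ := hind (max K k) (le_max_left _ _)
  have h1 := hM z' (closedBall_subset_closedBall (by
    gcongr
    linarith [show 0 ≤ 1 / (((max K k : ℕ) : ℝ) + 1) by positivity]) hz')
  have h2 : (k : ℝ) ≤ (max K k : ℕ) := by exact_mod_cast le_max_right _ _
  linarith

theorem isClosed_isDiscrete_iUnion_of_norm_ge {E : Type*} [NormedAddCommGroup E]
    {t : ℕ → Set E} (ht : ∀ k, (t k).Finite)
    (h : ∀ k, ∀ w ∈ t k, (k : ℝ) - 2 ≤ ‖w‖) : IsClosed (⋃ k, t k) ∧ IsDiscrete (⋃ k, t k) := by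
  have hlf : LocallyFinite t := fun x => by
    obtain ⟨m, hm⟩ := exists_nat_gt (‖x‖ + 3)
    refine ⟨ball x 1, ball_mem_nhds _ one_pos, (finite_Iio m).subset ?_⟩
    rintro k ⟨w, hw, hwx⟩
    have h1 := h k w hw
    have h2 := norm_sub_norm_le w x
    rw [mem_ball, dist_eq_norm] at hwx
    exact_mod_cast (by linarith : (k : ℝ) < m)
  have hclosed : ∀ T : Set E, IsClosed (⋃ k, t k ∩ T) := fun T =>
    (hlf.subset fun k => inter_subset_left).isClosed_iUnion
      fun k => ((ht k).inter_of_left T).isClosed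
  refine ⟨by simpa using hclosed univ, isDiscrete_iff_forall_mem_exists_isOpen.2 fun x hx => ?_⟩
  refine ⟨_, (hclosed {x}ᶜ).isOpen_compl, ?_⟩
  rw [← iUnion_inter]
  ext y
  simp only [mem_inter_iff, mem_compl_iff, mem_singleton_iff, not_and, not_not]
  exact ⟨fun hy => hy.1 hy.2, by rintro rfl; exact ⟨fun _ => rfl, hx⟩⟩

/-- The unavoidable set: every entire map `F` that is not everywhere degenerate hits `D` at a point
where it is nondegenerate. `D` is the union over `k` of finite sets for the maps of size about `k`
with `|det G'(0)| ≥ 1 / (k + 1)`. By the growth lemma, a rescaling `z ↦ F (a + s z)` with `s ≥ 1`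
belongs to one of these classes. -/
theorem exists_isClosed_isDiscrete_forall_exists_mem_det_fderiv_ne_zero
    (E : Type*) [NormedAddCommGroup E] [NormedSpace ℂ E] [FiniteDimensional ℂ E] [Nontrivial E] :
    ∃ D : Set E, (IsClosed D ∧ IsDiscrete D) ∧ ∀ F : E → E, ContDiff ℂ 2 F →
      (∃ z, (fderiv ℂ F z).det ≠ 0) → ∃ z, F z ∈ D ∧ (fderiv ℂ F z).det ≠ 0 := by
  have : ProperSpace E := FiniteDimensional.proper ℂ _
  have hR : ∀ k : ℕ, 1 < (2 - 1 / ((k : ℝ) + 2)) / (2 - 1 / (k + 1)) := fun k => by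
    have h1 : 1 / ((k : ℝ) + 1) ≤ 1 := by
      rw [div_le_one (by positivity)]
      linarith [(Nat.cast_nonneg k : (0 : ℝ) ≤ k)]
    have h2 : 1 / ((k : ℝ) + 2) < 1 / (k + 1) := by gcongr; norm_num
    rw [one_lt_div (by linarith)]
    linarith
  choose t htf ht hhit using fun k : ℕ => exists_finite_forall_exists_mem_det_fderiv_ne_zero
    (E := E) (hR k) (Nat.one_div_pos_of_nat (α := ℝ) (n := k)) (Nat.cast_nonneg (α := ℝ) k)
  refine ⟨⋃ k, t k, isClosed_isDiscrete_iUnion_of_norm_ge htf ht, fun F hF ⟨a, ha⟩ => ?_⟩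
  have hFd : Differentiable ℂ F := hF.differentiable two_ne_zero
  have hunb : ∀ M : ℝ, ∃ z, M ≤ ‖F (a + z)‖ := by
    by_contra! hM
    obtain ⟨M, hM⟩ := hM
    have hc : F = fun _ => F a := by
      ext z
      refine hFd.apply_eq_apply_of_bounded (isBounded_iff_forall_norm_le.2 ⟨M, ?_⟩) _ _
      rintro _ ⟨z, rfl⟩
      simpa using (hM (z - a)).le
    apply ha
    rw [hc]
    simp [ContinuousLinearMap.det]
  obtain ⟨K, hK⟩ := exists_nat_one_div_lt (norm_pos_iff.2 ha)
  obtain ⟨k, hk, s, hs, ⟨z₁, hz₁, hz₁k⟩, hbd⟩ := exists_norm_le_and_forall_norm_le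
    (F := fun z => F (a + z)) (by fun_prop) hunb K
  have hs0 : 0 < s := by linarith
  have hsC : (s : ℂ) ≠ 0 := by exact_mod_cast hs0.ne'
  have hns : ‖(s : ℂ)‖ = s := by simp [hs0.le]
  have hder : ∀ z, fderiv ℂ (fun z => F (a + (s : ℂ) • z)) z =
      (s : ℂ) • fderiv ℂ F (a + (s : ℂ) • z) := fun z => by
    have h1 : HasFDerivAt (fun z : E => a + (s : ℂ) • z) ((s : ℂ) • ContinuousLinearMap.id ℂ E) z :=
      ((hasFDerivAt_id z).const_smul (s : ℂ)).const_add a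
    rw [HasFDerivAt.fderiv (f := fun z => F (a + (s : ℂ) • z)) ((hFd _).hasFDerivAt.comp z h1)]
    ext v
    simp
  have hdet : ∀ z, (fderiv ℂ (fun z => F (a + (s : ℂ) • z)) z).det =
      (s : ℂ) ^ Module.finrank ℂ E * (fderiv ℂ F (a + (s : ℂ) • z)).det := fun z => by
    rw [hder]
    exact LinearMap.det_smul _ _
  suffices h : ∃ z, F (a + (s : ℂ) • z) ∈ t k ∧
      (fderiv ℂ (fun z => F (a + (s : ℂ) • z)) z).det ≠ 0 by
    obtain ⟨z, hz, hz'⟩ := h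
    exact ⟨_, mem_iUnion_of_mem k hz, right_ne_zero_of_mul (hdet z ▸ hz')⟩
  refine hhit k (fun z => F (a + (s : ℂ) • z)) (by fun_prop) ?_ ?_ ?_
  · intro z hz
    refine hbd _ ?_
    rw [mem_closedBall_zero_iff] at hz ⊢
    rw [norm_smul, hns]
    gcongr
  · refine ⟨(s : ℂ)⁻¹ • z₁, ?_, by simpa [smul_smul, hsC] using hz₁k⟩
    rw [mem_closedBall_zero_iff] at hz₁ ⊢
    rw [norm_smul, norm_inv, hns]
    exact inv_mul_le_one_of_le₀ hz₁ hs0.le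
  · rw [hdet, smul_zero, add_zero, norm_mul, norm_pow, hns]
    have h1 : 1 / ((k : ℝ) + 1) ≤ 1 / (K + 1) := by gcongr
    exact (h1.trans hK.le).trans (le_mul_of_one_le_left (norm_nonneg _) (one_le_pow₀ hs))

end UnavoidableSet

/-! ### Runge approximation on star-shaped compact sets -/

section Approximation

open Metric

variable {E F : Type*} [NormedAddCommGroup E] [NormedSpace ℂ E] [NormedAddCommGroup F]
  [NormedSpace ℂ F]

/-- `g` is, on `K`, a uniform limit of entire maps: it is within any `ε > 0` of one on `K`. -/
def IsEntirelyApproximable (K : Set E) (g : E → F) : Prop :=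
  ∀ ε > 0, ∃ h : E → F, ContDiff ℂ ω h ∧ ∀ z ∈ K, ‖g z - h z‖ ≤ ε

namespace IsEntirelyApproximable

variable {K : Set E}

theorem of_contDiff {g : E → F} (hg : ContDiff ℂ ω g) : IsEntirelyApproximable K g :=
  fun _ hε => ⟨g, hg, fun _ _ => by simpa using hε.le⟩

theorem add {g₁ g₂ : E → F} (h₁ : IsEntirelyApproximable K g₁)
    (h₂ : IsEntirelyApproximable K g₂) : IsEntirelyApproximable K fun z => g₁ z + g₂ z := by
  intro ε hε
  obtain ⟨f₁, hf₁, hd₁⟩ := h₁ (ε / 2) (half_pos hε)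
  obtain ⟨f₂, hf₂, hd₂⟩ := h₂ (ε / 2) (half_pos hε)
  refine ⟨fun z => f₁ z + f₂ z, hf₁.add hf₂, fun z hz => ?_⟩
  rw [add_sub_add_comm]
  exact (norm_add_le _ _).trans (by linarith [hd₁ z hz, hd₂ z hz])

theorem const_smul {g : E → F} (h : IsEntirelyApproximable K g) (c : ℂ) :
    IsEntirelyApproximable K fun z => c • g z := by
  intro ε hε
  obtain ⟨f, hf, hd⟩ := h (ε / (‖c‖ + 1)) (by positivity)
  refine ⟨fun z => c • f z, hf.const_smul c, fun z hz => ?_⟩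
  rw [← smul_sub, norm_smul]
  calc ‖c‖ * ‖g z - f z‖ ≤ (‖c‖ + 1) * (ε / (‖c‖ + 1)) := by
        gcongr
        · linarith
        · exact hd z hz
    _ = ε := by field_simp

theorem sum {ι : Type*} (s : Finset ι) {g : ι → E → F}
    (h : ∀ i ∈ s, IsEntirelyApproximable K (g i)) :
    IsEntirelyApproximable K fun z => ∑ i ∈ s, g i z := by
  classical
  induction s using Finset.induction_on with
  | empty => simpa using of_contDiff contDiff_const
  | insert i s hi ih =>
    simp only [Finset.sum_insert hi]
    exact (h i (by simp)).add (ih fun j hj => h j (by simp [hj]))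

theorem of_forall_exists {g : E → F}
    (h : ∀ ε > 0, ∃ g', IsEntirelyApproximable K g' ∧ ∀ z ∈ K, ‖g z - g' z‖ ≤ ε) :
    IsEntirelyApproximable K g := by
  intro ε hε
  obtain ⟨g', hg', hd⟩ := h (ε / 2) (half_pos hε)
  obtain ⟨f, hf, hd'⟩ := hg' (ε / 2) (half_pos hε)
  refine ⟨f, hf, fun z hz => ?_⟩
  linarith [norm_sub_le_norm_sub_add_norm_sub (g z) (g' z) (f z), hd z hz, hd' z hz]

end IsEntirelyApproximable

/-- The derivative at `a = 0` of `a ↦ G (w + a • z, z)`, as a function of `(w, z)`. -/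
noncomputable def radialDeriv (G : E × E → F) (p : E × E) : F := fderiv ℂ G p (p.2, 0)

theorem contDiffOn_radialDeriv_iterate {G : E × E → F} {s : Set (E × E)} (hs : IsOpen s)
    (hG : ContDiffOn ℂ ω G s) (k : ℕ) : ContDiffOn ℂ ω (radialDeriv^[k] G) s := by
  induction k with
  | zero => exact hG
  | succ k ih =>
    rw [Function.iterate_succ_apply']
    exact (ih.fderiv_of_isOpen hs (by simp)).clm_apply (by fun_prop)

/-- The Taylor coefficients at `a` of `a ↦ G (a • z, z)` are again of the form `G' (a • z, z)`. -/
theorem iteratedDeriv_radial {G : E × E → F} {s : Set (E × E)} (hs : IsOpen s)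
    (hG : ContDiffOn ℂ ω G s) (z : E) (k : ℕ) (a : ℂ) (ha : (a • z, z) ∈ s) :
    iteratedDeriv k (fun a : ℂ => G (a • z, z)) a = radialDeriv^[k] G (a • z, z) := by
  induction k generalizing a with
  | zero => simp
  | succ k ih =>
    rw [iteratedDeriv_succ, Function.iterate_succ_apply']
    have hev : iteratedDeriv k (fun a : ℂ => G (a • z, z)) =ᶠ[𝓝 a]
        fun a => radialDeriv^[k] G (a • z, z) := by
      have hc : Continuous fun a : ℂ => (a • z, z) := by fun_prop
      filter_upwards [hc.continuousAt.preimage_mem_nhds (hs.mem_nhds ha)] with b hb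
      exact ih b hb
    rw [hev.deriv_eq]
    have h1 : HasDerivAt (fun a : ℂ => (a • z, z)) (z, 0) a := by
      simpa using ((hasDerivAt_id a).smul_const z).prodMk (hasDerivAt_const a z)
    have h2 : HasFDerivAt (radialDeriv^[k] G)
        (fderiv ℂ (radialDeriv^[k] G) (a • z, z)) (a • z, z) :=
      (((contDiffOn_radialDeriv_iterate hs hG k).contDiffAt (hs.mem_nhds ha)).differentiableAt
        (by simp)).hasFDerivAt
    exact (h2.comp_hasDerivAt a h1).deriv

/-- If at radius `t` the functions `z ↦ G (t • z, z)` are approximable for all holomorphic `G`, then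
they are so at each nearby radius `t'`: the Taylor series of `a ↦ G (a • z, z)` at `t` converges at
`t'` uniformly in `z ∈ K`, and its coefficients are approximable by assumption. The second argument
of `G` serves to make the class of functions stable under taking these coefficients. -/
theorem isEntirelyApproximable_radial_step [CompleteSpace F] {K U : Set E} (hK : IsCompact K)
    (hU : IsOpen U) {t t' : ℂ} {r : ℝ} (hr : 0 < r) (htr : ‖t' - t‖ ≤ r / 2)
    (hKU : ∀ z ∈ K, ∀ a ∈ closedBall t r, a • z ∈ U)
    (ht : ∀ G : E × E → F, ContDiffOn ℂ ω G (U ×ˢ univ) →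
      IsEntirelyApproximable K fun z => G (t • z, z))
    (G : E × E → F) (hG : ContDiffOn ℂ ω G (U ×ˢ univ)) :
    IsEntirelyApproximable K fun z => G (t' • z, z) := by
  have hs : IsOpen (U ×ˢ (univ : Set E)) := hU.prod isOpen_univ
  obtain ⟨C, hC⟩ := ((isCompact_closedBall t r).prod hK).exists_bound_of_continuousOn
    (f := fun p : ℂ × E => G (p.1 • p.2, p.2))
    (hG.continuousOn.comp (by fun_prop) fun p hp => ⟨hKU _ hp.2 _ hp.1, mem_univ _⟩)
  refine IsEntirelyApproximable.of_forall_exists fun ε hε => ?_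
  obtain ⟨m, hm⟩ : ∃ m : ℕ, C * (1 / 2) ^ m / (1 - 1 / 2) ≤ ε := by
    have : Filter.Tendsto (fun m : ℕ => C * (1 / 2 : ℝ) ^ m / (1 - 1 / 2)) Filter.atTop (𝓝 0) := by
      simpa using ((tendsto_pow_atTop_nhds_zero_of_lt_one (r := (1 / 2 : ℝ)) (by norm_num)
        (by norm_num)).const_mul C).div_const (1 - 1 / 2)
    exact (this.eventually_le_const hε).exists
  refine ⟨fun z => ∑ k ∈ Finset.range m,
    ((k.factorial : ℂ)⁻¹ * (t' - t) ^ k) • radialDeriv^[k] G (t • z, z),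
    IsEntirelyApproximable.sum _ fun k _ =>
      (ht _ (contDiffOn_radialDeriv_iterate hs hG k)).const_smul _, fun z hz => ?_⟩
  have hcb : ∀ a ∈ closedBall t r, (a • z, z) ∈ U ×ˢ (univ : Set E) := fun a ha =>
    ⟨hKU z hz a ha, mem_univ _⟩
  have hdiff : DifferentiableOn ℂ (fun a : ℂ => G (a • z, z)) (closedBall t r) :=
    (hG.differentiableOn (by simp)).comp (by fun_prop) hcb
  have hsum := Complex.hasSum_taylorSeries_on_ball (hdiff.mono ball_subset_closedBall)
    (z := t') (by rw [mem_ball, dist_eq_norm]; linarith)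
  have hbd : ∀ k : ℕ, ‖((k.factorial : ℂ)⁻¹ * (t' - t) ^ k) • radialDeriv^[k] G (t • z, z)‖ ≤
      C * (1 / 2) ^ k := fun k => by
    have h1 := Complex.norm_iteratedDeriv_le_of_forall_mem_sphere_norm_le k hr
      (hdiff.diffContOnCl_ball subset_rfl)
      fun a ha => hC (a, z) ⟨sphere_subset_closedBall ha, hz⟩
    rw [iteratedDeriv_radial hs hG z k t (hcb t (mem_closedBall_self hr.le))] at h1
    have hC0 : 0 ≤ C := (norm_nonneg _).trans (hC (t, z) ⟨mem_closedBall_self hr.le, hz⟩)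
    rw [norm_smul, norm_mul, norm_inv, Complex.norm_natCast, norm_pow]
    have hk : (0 : ℝ) < k.factorial := by exact_mod_cast k.factorial_pos
    calc (k.factorial : ℝ)⁻¹ * ‖t' - t‖ ^ k * ‖radialDeriv^[k] G (t • z, z)‖
        ≤ (k.factorial : ℝ)⁻¹ * (r / 2) ^ k * (k.factorial * C / r ^ k) := by gcongr
      _ = C * (1 / 2) ^ k := by
        rw [div_pow, div_pow, one_pow]
        field_simp
  have := norm_sub_le_of_geometric_bound_of_hasSum (by norm_num) hbd (a := G (t' • z, z)) ?_ m
  · rw [norm_sub_rev]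
    exact this.trans hm
  · convert hsum using 2 with k
    rw [iteratedDeriv_radial hs hG z k t (hcb t (mem_closedBall_self hr.le)), mul_smul]

/-- Runge's theorem for a star-shaped compact set: the radius `t` is moved from `0`, where
`z ↦ G (0, z)` is entire, to `1` in steps of a length that depends only on `K` and `U`. -/
theorem isEntirelyApproximable_of_starConvex_zero [CompleteSpace F] {K U : Set E}
    (hK : IsCompact K) (hstar : StarConvex ℝ 0 K) (hU : IsOpen U) (hKU : K ⊆ U)
    (h0 : (0 : E) ∈ K) {f : E → F} (hf : ContDiffOn ℂ ω f U) : IsEntirelyApproximable K f := by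
  obtain ⟨ε, hε, hεU⟩ := hK.exists_cthickening_subset_open hU hKU
  obtain ⟨M, hM⟩ := hK.isBounded.exists_pos_norm_le
  obtain ⟨hM0, hM⟩ := hM
  set r := ε / M with hr
  have hr0 : 0 < r := by positivity
  have hball : ∀ t ∈ Icc (0 : ℝ) 1, ∀ z ∈ K, ∀ a ∈ closedBall (t : ℂ) r, a • z ∈ U := by
    intro t ht z hz a ha
    refine hεU (mem_cthickening_of_dist_le _ (t • z) ε K (hstar.smul_mem hz ht.1 ht.2) ?_)
    rw [dist_eq_norm, ← Complex.coe_smul, ← sub_smul, norm_smul]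
    rw [mem_closedBall, dist_eq_norm] at ha
    calc ‖a - t‖ * ‖z‖ ≤ ε / M * M := by gcongr; exact hM z hz
      _ = ε := by field_simp
  -- radii advance by `1 / (m + 1) < r / 2`, where `r` is the radius of convergence
  obtain ⟨m, hm⟩ := exists_nat_one_div_lt (half_pos hr0)
  have key : ∀ j : ℕ, j ≤ m + 1 → ∀ G : E × E → F, ContDiffOn ℂ ω G (U ×ˢ univ) →
      IsEntirelyApproximable K fun z => G (((j / (m + 1) : ℝ) : ℂ) • z, z) := by
    intro j
    induction j with
    | zero =>
      intro _ G hG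
      simp only [CharP.cast_eq_zero, zero_div, Complex.ofReal_zero, zero_smul]
      exact .of_contDiff
        (contDiffOn_univ.1 (hG.comp (by fun_prop) fun z _ => ⟨hKU h0, mem_univ _⟩))
    | succ j ih =>
      intro hj
      refine isEntirelyApproximable_radial_step hK hU hr0 ?_
        (hball (j / (m + 1)) ⟨by positivity, ?_⟩) (ih (by omega))
      · rw [← Complex.ofReal_sub, Complex.norm_real, ← sub_div]
        push_cast
        rw [add_sub_cancel_left, Real.norm_of_nonneg (by positivity)]
        exact hm.le
      · rw [div_le_one (by positivity)]
        exact_mod_cast (by omega : j ≤ m + 1)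
  have h := key (m + 1) le_rfl (fun p => f p.1) (hf.comp contDiffOn_fst fun p hp => hp.1)
  have h1 : (((m + 1 : ℕ) / (m + 1) : ℝ) : ℂ) = 1 := by
    push_cast
    exact div_self (by exact_mod_cast m.succ_ne_zero)
  simpa only [h1, one_smul] using h

theorem isEntirelyApproximable_of_starConvex [CompleteSpace F] {K U : Set E} {x : E}
    (hK : IsCompact K) (hx : x ∈ K) (hstar : StarConvex ℝ x K) (hU : IsOpen U) (hKU : K ⊆ U)
    {f : E → F} (hf : ContDiffOn ℂ ω f U) : IsEntirelyApproximable K f := by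
  have hstar' : StarConvex ℝ 0 ((fun z => x + z) ⁻¹' K) := by
    rw [← add_zero x] at hstar
    exact hstar.preimage_add_right
  have h := isEntirelyApproximable_of_starConvex_zero (U := (fun z => x + z) ⁻¹' U)
    ((Homeomorph.addLeft x).isCompact_preimage.2 hK) hstar' (hU.preimage (by fun_prop))
    (preimage_mono hKU) (by simpa using hx)
    (hf.comp (g := f) (f := fun z => x + z) (by fun_prop) fun z hz => hz)
  intro ε hε
  obtain ⟨g, hg, hd⟩ := h ε hε
  refine ⟨fun z => g (z - x), hg.comp (by fun_prop), fun z hz => ?_⟩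
  simpa using hd (z - x) (by simpa using hz)

theorem isOka_Cn (n : ℕ) : IsOka n (Cn n) := by
  intro N K U hK hconv hU hKU f hf φ hφ
  have : CompactSpace K := isCompact_iff_compactSpace.1 hK
  rw [contMDiffOn_iff_contDiffOn] at hf
  rw [Metric.mem_closure_iff]
  intro ε hε
  obtain ⟨g, hg, hd⟩ : ∃ g : Cn N → Cn n, ContDiff ℂ ω g ∧ ∀ z ∈ K, ‖f z - g z‖ ≤ ε / 2 := by
    rcases K.eq_empty_or_nonempty with rfl | ⟨x, hx⟩
    · exact ⟨fun _ => 0, contDiff_const, by simp⟩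
    · exact isEntirelyApproximable_of_starConvex hK hx (hconv.starConvex hx) hU hKU hf _
        (half_pos hε)
  refine ⟨⟨fun x => g x, by have := hg.continuous; fun_prop⟩, ⟨g, hg.contMDiff, fun _ => rfl⟩, ?_⟩
  refine ((ContinuousMap.dist_le (half_pos hε).le).2 fun x => ?_).trans_lt (half_lt_self hε)
  rw [dist_eq_norm, hφ]
  exact hd x x.2

end Approximation

/-! ### Projective space is compact -/

section Proj

open Metric

variable {n : ℕ}

instance Proj.compactSpace : CompactSpace (ℙ ℂ (Cn n)) := by
  have h0 : ∀ v : sphere (0 : Cn n) 1, v.1 ≠ 0 := fun v => ne_zero_of_mem_unit_sphere v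
  have hc : Continuous fun v : sphere (0 : Cn n) 1 => Projectivization.mk' ℂ ⟨v.1, h0 v⟩ :=
    Proj.continuous_mk'.comp (by fun_prop)
  refine Function.Surjective.compactSpace hc fun x => ?_
  have hx := norm_ne_zero_iff.2 x.rep_nonzero
  have hxC : ((‖x.rep‖⁻¹ : ℝ) : ℂ) ≠ 0 := by exact_mod_cast inv_ne_zero hx
  refine ⟨⟨((‖x.rep‖⁻¹ : ℝ) : ℂ) • x.rep, by simp [norm_smul, hx]⟩, ?_⟩
  conv_rhs => rw [← x.mk_rep]
  exact (Projectivization.mk_eq_mk_iff' ℂ _ _ _ _).2 ⟨_, rfl⟩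

theorem Proj.isClosed_setOf_mem_submodule :
    IsClosed {q : Cn n × ℙ ℂ (Cn n) | q.1 ∈ q.2.submodule} := by
  have hq := (IsOpenQuotientMap.id (X := Cn n)).prodMap (Proj.isOpenQuotientMap_mk' (n := n))
  rw [← hq.isQuotientMap.isClosed_preimage]
  have : Prod.map id (Projectivization.mk' ℂ) ⁻¹' {q : Cn n × ℙ ℂ (Cn n) | q.1 ∈ q.2.submodule} =
      {q | ∀ i j, q.1 i * q.2.1 j = q.1 j * q.2.1 i} := by
    ext ⟨v, w, hw⟩
    simp only [mem_preimage, Prod.map_apply, id_eq, mem_ofPred_eq, Projectivization.mk'_eq_mk,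
      Projectivization.submodule_mk, Submodule.mem_span_singleton]
    constructor
    · rintro ⟨a, rfl⟩ i j
      simp only [PiLp.smul_apply, smul_eq_mul]
      ring
    · intro h
      obtain ⟨i, hi⟩ : ∃ i, w i ≠ 0 := by
        by_contra! hc
        exact hw (by ext i; exact hc i)
      refine ⟨v i / w i, ?_⟩
      ext j
      have := h i j
      simp only [PiLp.smul_apply, smul_eq_mul]
      field_simp
      linear_combination this
  rw [this]
  simp only [ofPred_forall]
  refine isClosed_iInter fun i => isClosed_iInter fun j => isClosed_eq ?_ ?_ <;> fun_prop

end Proj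

/-! ### Analytic subsets -/

theorem isAnalyticSubset_setOf_eq {n : ℕ} {E H M : Type*} [NormedAddCommGroup E] [NormedSpace ℂ E]
    [TopologicalSpace H] {I : ModelWithCorners ℂ E H} [TopologicalSpace M] [ChartedSpace H M]
    {φ ψ : M → Cn n} (hφ : ContMDiff I 𝓘(ℂ, Cn n) ω φ) (hψ : ContMDiff I 𝓘(ℂ, Cn n) ω ψ) :
    IsAnalyticSubset I {x | φ x = ψ x} := by
  refine fun x => ⟨univ, isOpen_univ, mem_univ _, n, fun j x => φ x j - ψ x j, fun j => ?_, ?_⟩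
  · have h : ContDiff ℂ ω fun q : Cn n × Cn n => q.1 j - q.2 j := by fun_prop
    exact (h.comp_contMDiff (hφ.prodMk_space hψ)).contMDiffOn
  · ext x
    simp only [inter_univ, mem_univ, true_and, mem_ofPred_eq, sub_eq_zero]
    exact ⟨fun h j => by rw [h], fun h => by ext j; exact h j⟩

theorem isAnalyticSubset_of_isClosed_isDiscrete {n : ℕ} {D : Set (Cn n)}
    (hD : IsClosed D ∧ IsDiscrete D) : IsAnalyticSubset 𝓘(ℂ, Cn n) D := by
  intro x
  by_cases hx : x ∈ D
  · obtain ⟨U, hU, h⟩ := isOpen_inter_eq_singleton_of_mem_discrete hD.2 hx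
    have hxU : x ∈ U := (h.symm ▸ mem_singleton x : x ∈ U ∩ D).1
    obtain ⟨V, hV, hxV, k, f, hf, hfV⟩ :=
      isAnalyticSubset_setOf_eq (contMDiff_id (I := 𝓘(ℂ, Cn n))) (contMDiff_const (c := x)) x
    refine ⟨V ∩ U, hV.inter hU, ⟨hxV, hxU⟩, k, f, fun j => (hf j).mono inter_subset_left, ?_⟩
    rw [inter_comm V U, ← inter_assoc, inter_comm D U, h]
    ext y
    have h1 := Set.ext_iff.1 hfV y
    have h2 := Set.ext_iff.1 h y
    simp only [mem_inter_iff, mem_ofPred_eq, mem_singleton_iff, id] at h1 h2 ⊢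
    constructor
    · rintro ⟨rfl, hy⟩
      exact ⟨⟨hxU, hy⟩, (h1.1 ⟨rfl, hy⟩).2⟩
    · rintro ⟨⟨_, hy⟩, hf⟩
      exact h1.2 ⟨hy, hf⟩
  · refine ⟨Dᶜ, hD.1.isOpen_compl, hx, 1, fun _ _ => 1, fun _ => contMDiffOn_const, ?_⟩
    ext y
    simp

theorem isNowhereDense_of_isClosed_isDiscrete {n : ℕ} (hn : 0 < n) {D : Set (Cn n)}
    (hD : IsClosed D ∧ IsDiscrete D) : IsNowhereDense D := by
  have : Nonempty (Fin n) := ⟨⟨0, hn⟩⟩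
  rw [hD.1.isNowhereDense_iff, interior_eq_empty_iff_dense_compl]
  exact (Set.countable_coe_iff.1 (Blowup.countable hD)).dense_compl ℂ

/-! ### The blow-down map is a proper modification -/

namespace Blowup

variable {n : ℕ} {D : Set (Cn n)} {hD : IsClosed D ∧ IsDiscrete D}

/-- The blow-down map is the projection of a closed subset of `ℂⁿ × ∏ ℙ` along a compact space. -/
theorem isProperMap_proj : IsProperMap (proj : Blowup D hD → Cn n) := by
  have hcl : IsClosed {p : Cn n × (D → ℙ ℂ (Cn n)) | ∀ d : D, p.1 - d ∈ (p.2 d).submodule} := by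
    simp only [ofPred_forall]
    exact isClosed_iInter fun d => Proj.isClosed_setOf_mem_submodule.preimage
      (f := fun p : Cn n × (D → ℙ ℂ (Cn n)) => (p.1 - d, p.2 d)) (by fun_prop)
  exact isProperMap_fst_of_compactSpace.comp hcl.isClosedEmbedding_subtypeVal.isProperMap

theorem surjective_proj (hn : 0 < n) : Function.Surjective (proj : Blowup D hD → Cn n) := by
  classical
  intro z
  refine ⟨⟨(z, fun d => if h : z - d = 0 then
    Projectivization.mk ℂ (dir ⟨0, hn⟩ 0) (dir_ne_zero _ _) else Projectivization.mk ℂ (z - d) h),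
    fun d => ?_⟩, rfl⟩
  by_cases h : z - d = 0
  · simp [h]
  · simp only [dif_neg h]
    exact Proj.mem_submodule_mk _

theorem nonempty (hn : 0 < n) : Nonempty (Blowup D hD) :=
  ⟨(surjective_proj hn 0).choose⟩

theorem exists_mem_source_affineChart (p : Blowup D hD) (hp : p.proj ∈ D) :
    ∃ i, p ∈ (affineChart ⟨p.proj, hp⟩ i : OpenPartialHomeomorph (Blowup D hD) _).source := by
  obtain ⟨i, hi⟩ : ∃ i, (p.line ⟨_, hp⟩).rep i ≠ 0 := by
    by_contra! hc
    exact (p.line ⟨_, hp⟩).rep_nonzero (by ext i; exact hc i)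
  exact ⟨i, by simp, hi⟩

theorem contMDiffOn_affineChart (d : D) (i : Fin n) :
    ContMDiffOn 𝓘(ℂ, Cn n) 𝓘(ℂ, Cn n) ω (coord d i : Blowup D hD → Cn n)
      (affineChart d i : OpenPartialHomeomorph (Blowup D hD) _).source :=
  contMDiffOn_of_mem_maximalAtlas (e := affineChart d i)
    (StructureGroupoid.subset_maximalAtlas _ (Or.inr ⟨d, i, rfl⟩))

theorem contMDiff_proj : ContMDiff 𝓘(ℂ, Cn n) 𝓘(ℂ, Cn n) ω (proj : Blowup D hD → Cn n) := by
  intro p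
  have : Nonempty (Blowup D hD) := ⟨p⟩
  by_cases hp : p.proj ∈ D
  · obtain ⟨i, hi⟩ := exists_mem_source_affineChart p hp
    have h1 := ((contDiff_center ⟨p.proj, hp⟩ i).contMDiff.comp_contMDiffOn
      (contMDiffOn_affineChart (hD := hD) ⟨p.proj, hp⟩ i)).contMDiffAt
        ((OpenPartialHomeomorph.open_source _).mem_nhds hi)
    refine h1.congr_of_eventuallyEq ?_
    filter_upwards [(OpenPartialHomeomorph.open_source _).mem_nhds hi] with q hq
    exact (center_coord _ i q hq.2).symm
  · exact (contMDiffOn_of_mem_maximalAtlas (e := baseChart)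
      (StructureGroupoid.subset_maximalAtlas _ (Or.inl ⟨this, rfl⟩))).contMDiffAt
        ((OpenPartialHomeomorph.open_source _).mem_nhds hp)

theorem contMDiffOn_lift [Nonempty (Blowup D hD)] :
    ContMDiffOn 𝓘(ℂ, Cn n) 𝓘(ℂ, Cn n) ω (lift : Cn n → Blowup D hD) Dᶜ :=
  contMDiffOn_symm_of_mem_maximalAtlas (e := baseChart)
    (StructureGroupoid.subset_maximalAtlas _ (Or.inl ⟨inferInstance, rfl⟩))

theorem lift_proj [Nonempty (Blowup D hD)] {p : Blowup D hD} (hp : p.proj ∉ D) :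
    lift p.proj = p :=
  (baseChart (hD := hD)).left_inv hp

/-- The graph of the blow-down map is a bimeromorphic correspondence. -/
theorem isBimeromorphic (hn : 0 < n) : IsBimeromorphic n n (Cn n) (Blowup D hD) := by
  have : Nonempty (Blowup D hD) := nonempty hn
  let Γ : Set (Cn n × Blowup D hD) := {q | q.1 = q.2.proj}
  let h₁ : Γ ≃ₜ Blowup D hD :=
    { toFun := fun q => q.1.2
      invFun := fun p => ⟨(p.proj, p), rfl⟩
      left_inv := fun q => Subtype.ext (Prod.ext q.2.symm rfl)
      right_inv := fun _ => rfl
      continuous_toFun := by fun_prop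
      continuous_invFun := (continuous_proj.prodMk continuous_id).subtype_mk _ }
  let h₂ : ((Prod.swap ⁻¹' Γ : Set (Blowup D hD × Cn n))) ≃ₜ Blowup D hD :=
    { toFun := fun q => q.1.1
      invFun := fun p => ⟨(p, p.proj), rfl⟩
      left_inv := fun q => Subtype.ext (Prod.ext rfl (Eq.symm q.2))
      right_inv := fun _ => rfl
      continuous_toFun := by fun_prop
      continuous_invFun := (continuous_id.prodMk continuous_proj).subtype_mk _ }
  have hΓ : (fun q : Γ => q.1.1) = proj ∘ h₁ := funext fun q => q.2
  refine ⟨Γ, ⟨isAnalyticSubset_setOf_eq contMDiff_fst (contMDiff_proj.comp contMDiff_snd), ?_, ?_,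
    D, isAnalyticSubset_of_isClosed_isDiscrete hD, isNowhereDense_of_isClosed_isDiscrete hn hD,
    ?_, lift, contMDiffOn_lift, fun x hx y => ?_⟩,
    isAnalyticSubset_setOf_eq contMDiff_snd (contMDiff_proj.comp contMDiff_fst),
    h₂.isProperMap, h₂.surjective, ∅, ?_, by simp, ?_, proj, contMDiff_proj.contMDiffOn,
    fun x _ y => Iff.rfl⟩
  · rw [hΓ]
    exact isProperMap_proj.comp h₁.isProperMap
  · rw [hΓ]
    exact (surjective_proj hn).comp h₁.surjective
  · rintro ⟨z, p⟩ hzp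
    obtain rfl : z = p.proj := hzp
    exact map_mem_closure (f := fun q : Blowup D hD => (q.proj, q))
      (continuous_proj.prodMk continuous_id) (dense_compl_exceptional p) fun q hq => ⟨rfl, hq⟩
  · exact ⟨fun h => by rw [show x = y.proj from h] at hx ⊢; exact (lift_proj hx).symm,
      fun h => by rw [h]; exact (proj_lift hx).symm⟩
  · exact fun x => ⟨univ, isOpen_univ, mem_univ _, 1, fun _ _ => 1, fun _ => contMDiffOn_const,
      by simp⟩
  · exact subset_closure.trans (closure_mono fun q hq => ⟨hq, by simp⟩)

/-! ### Maps into the blowup -/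

/-- On the exceptional divisor `wᵢ = 0`, which the blow-down map contracts to `d`, that map is
degenerate: its derivative kills the directions along the divisor. -/
theorem det_fderiv_center_eq_zero (hn : 1 < n) (d : D) {i : Fin n} {w : Cn n} (hw : w i = 0) :
    (fderiv ℂ (center d i) w).det = 0 := by
  have : Nontrivial (Fin n) := Fin.nontrivial_iff_two_le.2 hn
  obtain ⟨j, hj⟩ := exists_ne i
  set v : Cn n := EuclideanSpace.single j 1
  have hvi : v i = 0 := by simp [v, hj.symm]
  have hd : DifferentiableAt ℂ (center d i) w := (contDiff_center d i).differentiable (by simp) w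
  have h1 : HasDerivAt (fun a : ℂ => center d i (w + a • v)) (fderiv ℂ (center d i) w v) 0 := by
    have h2 : HasDerivAt (fun a : ℂ => w + a • v) v 0 := by
      simpa using ((hasDerivAt_id (0 : ℂ)).smul_const v).const_add w
    exact HasFDerivAt.comp_hasDerivAt (l := center d i) 0 (by simpa using hd.hasFDerivAt) h2
  have h2 : (fun a : ℂ => center d i (w + a • v)) = fun _ => d.1 := by
    ext1 a
    simp [center, hvi, hw]
  have h3 : fderiv ℂ (center d i) w v = 0 := by
    rw [h2] at h1
    exact h1.unique (hasDerivAt_const _ _)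
  by_contra h
  have hinj : Function.Injective (fderiv ℂ (center d i) w) :=
    ((fderiv ℂ (center d i) w).toContinuousLinearEquivOfDetNeZero h).injective
  have : v = 0 := hinj (by simpa using h3)
  simpa [v] using congrArg (fun u : Cn n => u j) this

/-- A map to `ℂⁿ` that lifts to the blowup is degenerate wherever it meets `D`. -/
theorem det_fderiv_proj_comp_eq_zero (hn : 1 < n) {f : Cn n → Blowup D hD}
    (hf : ContMDiff 𝓘(ℂ, Cn n) 𝓘(ℂ, Cn n) ω f) {z : Cn n} (hz : (f z).proj ∈ D) :
    (fderiv ℂ (fun z => (f z).proj) z).det = 0 := by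
  obtain ⟨i, hi⟩ := exists_mem_source_affineChart (f z) hz
  set d : D := ⟨(f z).proj, hz⟩ with hd
  have hnhds := (OpenPartialHomeomorph.open_source _).mem_nhds hi
  have hw : DifferentiableAt ℂ (fun z => coord d i (f z)) z := by
    have := ((contMDiffOn_affineChart d i).contMDiffAt hnhds).comp z (hf z)
    exact (contMDiffAt_iff_contDiffAt.1 this).differentiableAt (by simp)
  have hev : (fun z => (f z).proj) =ᶠ[𝓝 z] center d i ∘ fun z => coord d i (f z) := by
    filter_upwards [hf.continuous.continuousAt.preimage_mem_nhds hnhds] with z' hz'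
    exact (center_coord d i _ hz'.2).symm
  rw [hev.fderiv_eq, fderiv_comp _ ((contDiff_center d i).differentiable (by simp) _) hw]
  refine (LinearMap.det_comp _ _).trans ?_
  rw [mul_eq_zero]
  exact Or.inl (det_fderiv_center_eq_zero hn d (by simp [coord, hd]))

/-- A map that is somewhere locally biholomorphic hits the complement of the exceptional set at a
point where it is locally biholomorphic, and there the blow-down map is biholomorphic. -/
theorem exists_det_fderiv_proj_comp_ne_zero {f : Cn n → Blowup D hD}
    (hf : ContMDiff 𝓘(ℂ, Cn n) 𝓘(ℂ, Cn n) ω f) {z : Cn n}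
    (hz : IsLocalDiffeomorphAt 𝓘(ℂ, Cn n) 𝓘(ℂ, Cn n) ω f z) :
    ∃ z, (fderiv ℂ (fun z => (f z).proj) z).det ≠ 0 := by
  have : Nonempty (Blowup D hD) := ⟨f z⟩
  obtain ⟨Φ, hzΦ, hΦ⟩ := hz
  obtain ⟨p, hpD, hpΦ⟩ := dense_compl_exceptional.exists_mem_open Φ.open_target
    ⟨_, Φ.map_source hzΦ⟩
  set z' := Φ.invFun p
  have hz'Φ : z' ∈ Φ.source := Φ.map_target hpΦ
  have hfz' : f z' = p := (hΦ hz'Φ).trans (Φ.right_inv hpΦ)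
  have hg : DifferentiableAt ℂ (fun w => Φ.invFun (lift w)) (f z').proj := by
    rw [hfz']
    have h1 : ContMDiffAt 𝓘(ℂ, Cn n) 𝓘(ℂ, Cn n) ω (lift : Cn n → Blowup D hD) p.proj :=
      contMDiffOn_lift.contMDiffAt (hD.1.isOpen_compl.mem_nhds hpD)
    have h2 : ContMDiffAt 𝓘(ℂ, Cn n) 𝓘(ℂ, Cn n) ω Φ.invFun (lift p.proj) := by
      rw [lift_proj hpD]
      exact Φ.contMDiffOn_invFun.contMDiffAt (Φ.open_target.mem_nhds hpΦ)
    exact (contMDiffAt_iff_contDiffAt.1 (h2.comp _ h1)).differentiableAt (by simp)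
  have hF : DifferentiableAt ℂ (fun z => (f z).proj) z' :=
    (contMDiff_iff_contDiff.1 (contMDiff_proj.comp hf)).differentiable (by simp) z'
  have hev : (fun w => Φ.invFun (lift w)) ∘ (fun z => (f z).proj) =ᶠ[𝓝 z'] id := by
    have hopen : IsOpen {p : Blowup D hD | p.proj ∉ D} :=
      hD.1.isOpen_compl.preimage continuous_proj
    filter_upwards [Φ.open_source.mem_nhds hz'Φ,
      hf.continuous.continuousAt.preimage_mem_nhds (hopen.mem_nhds (hfz' ▸ hpD))] with w hw hwD
    simp only [Function.comp_apply, id]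
    rw [lift_proj hwD, hΦ hw]
    exact Φ.left_inv hw
  refine ⟨z', fun h0 => ?_⟩
  have h1 := hev.fderiv_eq (𝕜 := ℂ)
  rw [fderiv_comp (f := fun z => (f z).proj) z' hg hF, fderiv_id] at h1
  have h2 := congrArg ContinuousLinearMap.det h1
  have h3 : ∀ A B : Cn n →L[ℂ] Cn n, (A.comp B).det = A.det * B.det := fun A B =>
    LinearMap.det_comp _ _
  rw [h3, h0, mul_zero] at h2
  exact zero_ne_one (h2.trans LinearMap.det_id)

/-- The inverse of the blow-down map on a small ball off `D` is not a limit of globally defined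
maps that are degenerate after blowing down: maps uniformly close to the identity on a ball have,
by Cauchy's estimate, an invertible derivative at its center. -/
theorem not_isOka_of_forall_det_fderiv_eq_zero (hn : 0 < n)
    (h : ∀ g : Cn n → Blowup D hD, ContMDiff 𝓘(ℂ, Cn n) 𝓘(ℂ, Cn n) ω g →
      ∀ z, (fderiv ℂ (fun z => (g z).proj) z).det = 0) : ¬ IsOka n (Blowup D hD) := by
  intro hOka
  have : Nonempty (Blowup D hD) := nonempty hn
  obtain ⟨p, hp⟩ := (dense_compl_exceptional (hD := hD)).nonempty
  obtain ⟨r, hr, hrD⟩ := Metric.isOpen_iff.1 hD.1.isOpen_compl p.proj hp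
  set K := Metric.closedBall p.proj (r / 2)
  have hKD : K ⊆ Dᶜ := (Metric.closedBall_subset_ball (half_lt_self hr)).trans hrD
  have : CompactSpace K := isCompact_iff_compactSpace.1 (isCompact_closedBall _ _)
  let φ : C(K, Blowup D hD) := ⟨K.domRestrict lift,
    continuousOn_iff_continuous_domRestrict.1 (contMDiffOn_lift.continuousOn.mono hKD)⟩
  have hφ := hOka n K Dᶜ (isCompact_closedBall _ _) (convex_closedBall _ _) hD.1.isOpen_compl
    hKD lift contMDiffOn_lift φ fun _ => rfl
  let π : C(Blowup D hD, Cn n) := ⟨proj, continuous_proj⟩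
  have hmem := map_mem_closure (ContinuousMap.continuous_postcomp π) hφ (mapsTo_image _ _)
  obtain ⟨_, ⟨ψ, ⟨g, hg, hψ⟩, rfl⟩, hdist⟩ :=
    Metric.mem_closure_iff.1 hmem (r / 8) (by positivity)
  have hG : Differentiable ℂ fun z => (g z).proj :=
    (contMDiff_iff_contDiff.1 (contMDiff_proj.comp hg)).differentiable (by simp)
  have hclose : ∀ z ∈ K, ‖(g z).proj - z‖ ≤ r / 8 := fun z hz => by
    have h1 := (ContinuousMap.dist_apply_le_dist (⟨z, hz⟩ : K)).trans hdist.le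
    rw [dist_comm, dist_eq_norm] at h1
    have h2 : (lift z : Blowup D hD).proj = z := proj_lift (hKD hz)
    simpa [π, φ, hψ, h2] using h1
  have hder : ‖fderiv ℂ (fun z => (g z).proj - z) p.proj‖ ≤ (2 * (r / 8)) / (r / 2) := by
    refine Complex.norm_fderiv_le_div_of_mapsTo_ball (hG.sub differentiable_id).differentiableOn
      (fun z hz => ?_) (half_pos hr)
    rw [Metric.mem_closedBall, dist_eq_norm]
    refine (norm_sub_le _ _).trans ?_
    linarith [hclose z (Metric.ball_subset_closedBall hz),
      hclose p.proj (Metric.mem_closedBall_self (by positivity))]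
  have hsub : fderiv ℂ (fun z => (g z).proj - z) p.proj =
      fderiv ℂ (fun z => (g z).proj) p.proj - ContinuousLinearMap.id ℂ (Cn n) := by
    rw [fderiv_fun_sub (hG _) differentiableAt_fun_id, fderiv_fun_id]
  refine det_ne_zero_of_norm_sub_lt (e := ContinuousLinearEquiv.refl ℂ (Cn n)) (B := 1)
    ContinuousLinearMap.norm_id_le ?_ (h g hg p.proj)
  rw [hsub] at hder
  rw [one_mul]
  refine hder.trans_lt ?_
  rw [div_lt_one (by positivity)]
  linarith

end Blowup

/-! ### A blowup of `ℂⁿ` that is not Oka -/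

theorem mainTheorem4 (n : ℕ) (hn : 1 < n) :
    ∃ (D : Set (Cn n)) (hD : IsClosed D ∧ IsDiscrete D),
      IsComplexManifold n (Blowup D hD) ∧
      IsBrodyVolumeHyperbolic n (Blowup D hD) ∧
      ¬ IsOka n (Blowup D hD) ∧
      IsOka n (Cn n) ∧
      IsBimeromorphic n n (Cn n) (Blowup D hD) := by
  have hn0 : 0 < n := by omega
  have : Nonempty (Fin n) := ⟨⟨0, hn0⟩⟩
  obtain ⟨D, hD, hU⟩ := exists_isClosed_isDiscrete_forall_exists_mem_det_fderiv_ne_zero (Cn n)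
  have hdeg : ∀ g : Cn n → Blowup D hD, ContMDiff 𝓘(ℂ, Cn n) 𝓘(ℂ, Cn n) ω g →
      ∀ z, (fderiv ℂ (fun z => (g z).proj) z).det = 0 := by
    by_contra! hcon
    obtain ⟨g, hg, hz⟩ := hcon
    obtain ⟨z, hzD, hz⟩ := hU _
      ((contMDiff_iff_contDiff.1 (Blowup.contMDiff_proj.comp hg)).of_le le_top) hz
    exact hz (Blowup.det_fderiv_proj_comp_eq_zero hn hg hzD)
  refine ⟨D, hD, Blowup.isComplexManifold hn, ?_,
    Blowup.not_isOka_of_forall_det_fderiv_eq_zero hn0 hdeg, isOka_Cn n,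
    Blowup.isBimeromorphic hn0⟩
  rintro ⟨f, hf, z, hz⟩
  obtain ⟨z', hz'⟩ := Blowup.exists_det_fderiv_proj_comp_ne_zero hf hz
  exact hz' (hdeg f hf z')
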